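/- For a graph $G$ and $X\subseteq V(G)$, let $N_G(X)$ be the set of vertices outside $X$ with at least one neighbour in $X$; all logarithms are in base $2$. A graph $G$ on $n$ vertices is a weak $(\varepsilon,s)$-expander if $|N_{G-F}(U)|\ge \varepsilon|U|/(\log n)^2$ for all $U\subseteq V(G)$ and $F\subseteq E(G)$ with $1\le|U|\le 2n/3$ and $|F|\le s|U|$, where $G-F$ is $G$ with the edges in $F$ removed. Lemma. For every $\delta>0$ there is $n_0$ such that the following holds for all $n\ge n_0$ and all real $\varepsilon, s$ with $2^{-9}\le\varepsilon<1$ and $s\ge 2^{11}(\log n)^{50}$. Let $G$ be an $n$-vertex weak $(\varepsilon,s)$-expander, and let $V$ be a random subset of $V(G)$ that includes each vertex independently with probability $\frac16$. Then, with probability at least $1-\delta$, for every $r$ and every sequence of distinct vertices $x_1,\dots,x_r,y_1,\dots,y_r$ of $G$ satisfying $|N_G(X)|\ge|X|(\log n)^{50}$ for every $X\subseteq\{x_1,\dots,x_r,y_1,\dots,y_r\}$, there are paths $P_1,\dots,P_r$ in $G$ such that $P_i$ is a path from $x_i$ to $y_i$ for each $i$, and the interiors of $P_1,\dots,P_r$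 are contained in $V$ and pairwise vertex-disjoint. -/

import Mathlib

/-- The neighbourhood `N_G(X)` of a set `X` of vertices: the vertices outside `X` that are joined
by an edge of `G` to at least one vertex of `X`. -/
noncomputable def outerNbhd {α : Type*} [Fintype α] (G : SimpleGraph α) (X : Finset α) :
    Finset α :=
  open Classical in Finset.univ.filter (fun v => v ∉ X ∧ ∃ u ∈ X, G.Adj u v)

/-- A graph `G` on `n` vertices is a weak `(ε, s)`-expander if
`|N_{G - F}(U)| ≥ ε |U| / (log₂ n) ^ 2` for every set `U` of vertices with `1 ≤ |U| ≤ 2n/3` and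
every set `F` of edges of `G` with `|F| ≤ s |U|`. -/
def IsWeakExpander {α : Type*} [Fintype α] (G : SimpleGraph α) (ε s : ℝ) : Prop :=
  ∀ (U : Finset α) (F : Finset (Sym2 α)),
    1 ≤ U.card → (U.card : ℝ) ≤ 2 * (Fintype.card α : ℝ) / 3 →
    (F : Set (Sym2 α)) ⊆ G.edgeSet → (F.card : ℝ) ≤ s * (U.card : ℝ) →
    ε * (U.card : ℝ) / Real.logb 2 (Fintype.card α : ℝ) ^ 2
      ≤ ((outerNbhd (G.deleteEdges (F : Set (Sym2 α))) U).card : ℝ)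

/-- The interior of a path: its vertices other than its two ends. -/
def pathInterior {α : Type*} {G : SimpleGraph α} {u v : α} (P : G.Path u v) : Set α :=
  {w | w ∈ P.1.support ∧ w ≠ u ∧ w ≠ v}

/-- The property of a vertex set `V` in question: for every `r` and all distinct vertices
`x₁, …, x_r, y₁, …, y_r` such that `|N(X)| ≥ |X| (log₂ n) ^ 50` for all
`X ⊆ {x₁, …, x_r, y₁, …, y_r}`, there are paths `P₁, …, P_r`, where `P_i` goes from `x_i` to `y_i`,
whose interiors are contained in `V` and pairwise disjoint. -/
def ConnectsThrough {α : Type*} [Fintype α] (G : SimpleGraph α) (V : Set α) : Prop :=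
  ∀ (r : ℕ) (x y : Fin r → α), Function.Injective (Sum.elim x y) →
    (∀ X : Finset α, (X : Set α) ⊆ Set.range x ∪ Set.range y →
      (X.card : ℝ) * Real.logb 2 (Fintype.card α : ℝ) ^ 50 ≤ ((outerNbhd G X).card : ℝ)) →
    ∃ P : (i : Fin r) → G.Path (x i) (y i),
      (∀ i, pathInterior (P i) ⊆ V) ∧
      (∀ i j, i ≠ j → Disjoint (pathInterior (P i)) (pathInterior (P j)))

/-- The law of the random subset of `α` that contains each element independently with
probability `1/6`. -/
noncomputable def sixthRandomSubset (α : Type*) : MeasureTheory.Measure (Set α) :=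
  ProbabilityTheory.setBernoulli (Set.univ : Set α) ⟨1 / 6, by norm_num, by norm_num⟩

/-! Put `l = ⌈log₂ (n + 1)⌉`; densities are such that a random set misses `l ^ 10` given vertices
with probability at most 1/2.

Expansion survives sampling. Suppose `U` had neither `|U| / l ^ 4` disjoint stars with `l ^ 25`
leaves outside `U`, nor as many outside vertices with `l ^ 12` neighbours each in `U` and little
overlap. Then deleting few edges would leave most of `U` with few neighbours, against weak expansion
(`PolyExpander.stars_or_neighbours`). Either structure is robust, so a random part of `U` still has
`|U| / l ^ 5` neighbours outside `U`, with failure probability exponentially small in `|U| / l ^ 30`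
(`PolyExpander.prob_few_neighbours_le`).

Exposing `V` in many independent rounds, the set reached from a well-expanding `X` grows to 3n/5
vertices, even avoiding a set `W` of size at most `l ^ 10 * |X|`. One half of `X` then accounts for
half of what is reached; regrow from it and halve again, until a single vertex of `X` reaches 3n/5
(`PolyExpander.prob_no_vertex_reaches_le`). The failure probability stays below about `2 ^ (-|X| * l
^ 18)`, which beats the union bound over all `X` and `W`.

Hence fewer than half of the `x i`, and of the `y i`, fail to reach 3n/5, so some pair reaches two
sets sharing n/5 vertices, and a fresh random set contains a meeting point
(`PolyExpander.prob_not_linked_le`). Greedily this joins half of the pairs by short disjoint paths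
(`Linked.joins`). Splitting `V` into at least `l` disjoint random parts, each halving the number of
unjoined pairs, joins them all. -/

/-! ### Random subsets: union bounds, exposure in rounds, splitting. -/

section RandomSubset

open Finset
open scoped Classical

variable {α κ μ : Type*} [Fintype α] [Fintype κ] [Fintype μ]

/-- The expectation of `F` at a random labelling of `α`, whose labels are independent and are
distributed according to the weights `w`. -/
noncomputable def labelExp (w : κ → ℝ) (F : (α → κ) → ℝ) : ℝ :=
  ∑ h : α → κ, (∏ v, w (h v)) * F h

/-- Relabelling each vertex separately keeps the labels independent, so only the one-vertex law has
to be compared. All couplings of random sets of different densities rest on this. -/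
lemma labelExp_comp [DecidableEq μ] (w : κ → ℝ) (w' : μ → ℝ) (φ : κ → μ)
    (hw : ∀ l, ∑ k with φ k = l, w k = w' l) (F : (α → μ) → ℝ) :
    labelExp w (fun h => F (φ ∘ h)) = labelExp w' F := by
  unfold labelExp
  rw [← Finset.sum_fiberwise (s := univ) (g := fun h : α → κ => φ ∘ h)]
  refine Finset.sum_congr rfl fun r _ => ?_
  simp_rw [← hw]
  rw [Finset.prod_univ_sum, Finset.sum_mul]
  refine Finset.sum_congr ?_ fun h hh => ?_
  · ext h
    simp [funext_iff]
  · rw [Fintype.mem_piFinset] at hh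
    have : φ ∘ h = r := by
      funext v
      simpa using hh v
    simp only [this]

lemma labelExp_mono {w : κ → ℝ} (hw : ∀ k, 0 ≤ w k) {F F' : (α → κ) → ℝ} (h : ∀ x, F x ≤ F' x) :
    labelExp w F ≤ labelExp w F' :=
  Finset.sum_le_sum fun x _ => mul_le_mul_of_nonneg_left (h x) (prod_nonneg fun _ _ => hw _)

lemma labelExp_add (w : κ → ℝ) (F F' : (α → κ) → ℝ) :
    labelExp w (fun x => F x + F' x) = labelExp w F + labelExp w F' := by
  simp [labelExp, mul_add, Finset.sum_add_distrib]

lemma labelExp_const {w : κ → ℝ} (hw : ∑ k, w k = 1) (c : ℝ) :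
    labelExp w (fun _ : α → κ => c) = c := by
  have := Finset.prod_univ_sum (fun _ : α => (univ : Finset κ)) (fun _ k => w k)
  simp only [hw, prod_const_one, Fintype.piFinset_univ] at this
  rw [labelExp, ← Finset.sum_mul, ← this, one_mul]

/-- The weights of a coin with success probability `p`. -/
noncomputable def coin (p : ℝ) (b : Bool) : ℝ := if b then p else 1 - p

lemma coin_nonneg {p : ℝ} (h0 : 0 ≤ p) (h1 : p ≤ 1) (b : Bool) : 0 ≤ coin p b := by
  cases b <;> simp [coin, h0, h1]

lemma sum_coin (p : ℝ) : ∑ b, coin p b = 1 := by simp [coin]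

/-- The set of the elements labelled `true`. -/
noncomputable def trueSet (f : α → Bool) : Finset α := univ.filter fun v => f v = true

/-- The indicator of a proposition. -/
noncomputable def ind (A : Prop) : ℝ := if A then 1 else 0

lemma ind_nonneg (A : Prop) : 0 ≤ ind A := by unfold ind; split_ifs <;> simp
lemma ind_le_one (A : Prop) : ind A ≤ 1 := by unfold ind; split_ifs <;> simp
lemma ind_mono {A B : Prop} (h : A → B) : ind A ≤ ind B := by
  unfold ind; split_ifs <;> simp_all

/-- The probability that the random subset of `α` containing each element independently with
probability `p` has the property `A`. -/
noncomputable def prob (p : ℝ) (A : Finset α → Prop) : ℝ :=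
  labelExp (coin p) fun f : α → Bool => ind (A (trueSet f))

variable {p : ℝ}

lemma prob_mono (h0 : 0 ≤ p) (h1 : p ≤ 1) {A B : Finset α → Prop} (h : ∀ V, A V → B V) :
    prob p A ≤ prob p B :=
  labelExp_mono (coin_nonneg h0 h1) fun _ => ind_mono (h _)

lemma prob_false : prob p (fun _ : Finset α => False) = 0 := by
  simp [prob, labelExp, ind]

lemma prob_or_le (h0 : 0 ≤ p) (h1 : p ≤ 1) (A B : Finset α → Prop) :
    prob p (fun V => A V ∨ B V) ≤ prob p A + prob p B := by
  unfold prob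
  rw [← labelExp_add]
  refine labelExp_mono (coin_nonneg h0 h1) fun f => ?_
  unfold ind
  split_ifs <;> simp_all

lemma prob_exists_le (h0 : 0 ≤ p) (h1 : p ≤ 1) {ι : Type*} (s : Finset ι)
    (A : ι → Finset α → Prop) :
    prob p (fun V => ∃ i ∈ s, A i V) ≤ ∑ i ∈ s, prob p (A i) := by
  induction s using Finset.induction_on with
  | empty => simp [prob_false]
  | insert i s hi ih =>
    rw [Finset.sum_insert hi]
    refine (prob_mono h0 h1 ?_).trans ((prob_or_le h0 h1 (A i) _).trans (by gcongr))
    intro V hV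
    simpa using hV

lemma prob_disjoint (p : ℝ) (S : Finset α) :
    prob p (fun V => Disjoint S V) = (1 - p) ^ S.card := by
  have key : ∀ f : α → Bool, (∏ v, coin p (f v)) * ind (Disjoint S (trueSet f)) =
      ∏ v, (if v ∈ S ∧ f v = true then 0 else coin p (f v)) := by
    intro f
    by_cases h : Disjoint S (trueSet f)
    · rw [ind, if_pos h, mul_one]
      refine prod_congr rfl fun v _ => ?_
      rw [if_neg]
      rintro ⟨h1, h2⟩
      exact Finset.disjoint_left.1 h h1 (by simp [trueSet, h2])
    · rw [ind, if_neg h, mul_zero]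
      obtain ⟨v, hv, hv'⟩ := Finset.not_disjoint_iff.1 h
      refine (Finset.prod_eq_zero (mem_univ v) ?_).symm
      rw [if_pos ⟨hv, by simpa [trueSet] using hv'⟩]
  unfold prob labelExp
  simp_rw [key]
  have := Finset.prod_univ_sum (fun _ : α => (univ : Finset Bool))
    (fun v b => if v ∈ S ∧ b = true then 0 else coin p b)
  rw [Fintype.piFinset_univ] at this
  rw [← this]
  have h2 : ∀ v : α, (∑ b : Bool, if v ∈ S ∧ b = true then 0 else coin p b) =
      if v ∈ S then 1 - p else 1 := by
    intro v
    by_cases hv : v ∈ S <;> simp [hv, coin]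
  simp_rw [h2]
  rw [Finset.prod_ite]
  simp

/-- The source of all failure probabilities below: each block of `N` elements is missed with
probability at most 1/2, so `m` blocks cost `2 ^ (-m)`, and a union bound over the family follows.
-/
lemma prob_exists_disjoint_le (h0 : 0 ≤ p) (h1 : p ≤ 1) {N m : ℕ} (hN : (1 - p) ^ N ≤ 1 / 2)
    (𝓕 : Finset (Finset α)) (h𝓕 : ∀ S ∈ 𝓕, N * m ≤ S.card) :
    prob p (fun V => ∃ S ∈ 𝓕, Disjoint S V) ≤ 𝓕.card * (1 / 2) ^ m := by
  refine (prob_exists_le h0 h1 𝓕 fun S V => Disjoint S V).trans ?_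
  rw [← nsmul_eq_mul]
  refine Finset.sum_le_card_nsmul _ _ _ fun S hS => ?_
  rw [prob_disjoint]
  calc (1 - p) ^ S.card ≤ (1 - p) ^ (N * m) :=
        pow_le_pow_of_le_one (by linarith) (by linarith) (h𝓕 S hS)
    _ = ((1 - p) ^ N) ^ m := pow_mul _ _ _
    _ ≤ _ := pow_le_pow_left₀ (pow_nonneg (by linarith) _) hN _

lemma labelExp_prod {κ' : Type*} [Fintype κ'] (w : κ → ℝ) (w' : κ' → ℝ)
    (F : (α → κ) → (α → κ') → ℝ) :
    labelExp (fun k : κ × κ' => w k.1 * w' k.2) (fun h => F (Prod.fst ∘ h) (Prod.snd ∘ h)) =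
      labelExp w fun f => labelExp w' fun g => F f g := by
  unfold labelExp
  rw [← (Equiv.arrowProdEquivProdArrow α (fun _ => κ) (fun _ => κ')).symm.sum_comp,
    Fintype.sum_prod_type]
  refine sum_congr rfl fun f _ => ?_
  rw [mul_sum]
  refine sum_congr rfl fun g _ => ?_
  rw [← mul_assoc, ← prod_mul_distrib]
  rfl

/-- A `c`-random set is the union of independent `a`-random and `b`-random sets if
`1 - c = (1 - a) * (1 - b)`. -/
lemma prob_union {a b c : ℝ} (hc : 1 - c = (1 - a) * (1 - b)) (A : Finset α → Prop) :
    prob c A = labelExp (coin a) fun f : α → Bool => prob b fun V => A (trueSet f ∪ V) := by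
  have h := labelExp_prod (α := α) (coin a) (coin b) fun f g => ind (A (trueSet f ∪ trueSet g))
  unfold prob
  rw [← h]
  have h2 := labelExp_comp (α := α) (fun k : Bool × Bool => coin a k.1 * coin b k.2) (coin c)
    (fun k => k.1 || k.2) (fun l => by
      rw [Finset.sum_filter, Fintype.sum_prod_type]
      cases l
      · simp [coin, hc]
      · simp [coin]
        linarith) fun f => ind (A (trueSet f))
  rw [← h2]
  congr 1
  funext x
  congr 2
  ext v
  simp [trueSet]

lemma prob_not_union_le {a b c q : ℝ} (ha0 : 0 ≤ a) (ha1 : a ≤ 1) (hb0 : 0 ≤ b) (hb1 : b ≤ 1)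
    (hq : 0 ≤ q) (hc : 1 - c = (1 - a) * (1 - b)) (A B : Finset α → Prop)
    (h : ∀ U, A U → prob b (fun V => ¬ B (U ∪ V)) ≤ q) :
    prob c (fun V => ¬ B V) ≤ prob a (fun V => ¬ A V) + q := by
  rw [prob_union hc]
  have : q = labelExp (coin a) fun _ : α → Bool => q := (labelExp_const (sum_coin a) q).symm
  rw [this]
  unfold prob
  rw [← labelExp_add]
  refine labelExp_mono (coin_nonneg ha0 ha1) fun f => ?_
  by_cases hA : A (trueSet f)
  · have := h _ hA
    have h2 := ind_nonneg (¬ A (trueSet f))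
    unfold prob at this
    linarith
  · rw [ind, if_pos hA]
    have : labelExp (coin b) (fun g : α → Bool => ind (¬ B (trueSet f ∪ trueSet g))) ≤
        labelExp (coin b) fun _ : α → Bool => 1 :=
      labelExp_mono (coin_nonneg hb0 hb1) fun _ => ind_le_one _
    rw [labelExp_const (sum_coin b)] at this
    linarith

/-- Exposing a random set in `T` rounds, each of which fails with probability at most `q`. -/
lemma prob_not_iterate_le {p q : ℝ} (hp : 0 < p) (hq : 0 ≤ q) (Q : ℕ → Finset α → Prop)
    (hQ0 : ∀ V, Q 0 V) (T : ℕ)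
    (hQ : ∀ t < T, ∀ U, Q t U → ∀ b, p ≤ b → b ≤ 1 →
      prob b (fun V => ¬ Q (t + 1) (U ∪ V)) ≤ q)
    (c : ℝ) (hc : T * p ≤ c) (hc1 : c ≤ 1) : prob c (fun V => ¬ Q T V) ≤ T * q := by
  induction T generalizing c with
  | zero => simp [hQ0, prob_false]
  | succ T ih =>
    push_cast at hc ⊢
    have hT : (0 : ℝ) ≤ T * p := by positivity
    have h1a : 0 < 1 - (c - p) := by linarith
    -- The density of the last round is forced by `1 - c = (1 - (c - p)) * (1 - b)`. It is at least
    -- `p` but not equal to it, which is why `hQ` allows every `b ≥ p`.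
    have hb1 : p / (1 - (c - p)) ≤ 1 := by rw [div_le_one h1a]; linarith
    have hbp : p ≤ p / (1 - (c - p)) := by
      rw [le_div_iff₀ h1a]
      nlinarith
    have := prob_not_union_le (a := c - p) (b := p / (1 - (c - p))) (c := c) (q := q)
      (by linarith) (by linarith) (by linarith) hb1 hq (by field_simp; ring) (Q T) (Q (T + 1))
      fun U hU => hQ T (Nat.lt_succ_self T) U hU _ hbp hb1
    have h2 := ih (fun t ht => hQ t (by omega)) (c - p) (by linarith) (by linarith)
    linarith

/-- A `p`-random set contains two disjoint sets, each of which is `p / 2`-random. -/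
lemma prob_not_split_le (h0 : 0 ≤ p) (h1 : p ≤ 1) (A B : Finset α → Prop)
    (h : ∀ U V W, U ⊆ W → V ⊆ W → Disjoint U V → A U → A V → B W) :
    prob p (fun V => ¬ B V) ≤ 2 * prob (p / 2) (fun V => ¬ A V) := by
  -- Three labels: outside the set, or in one of its two halves.
  let w : Option Bool → ℝ := fun k => if k = none then 1 - p else p / 2
  have hw : ∀ k, 0 ≤ w k := by
    intro k
    simp only [w]
    split_ifs <;> linarith
  have hB := labelExp_comp (α := α) w (coin p) (fun k => k.isSome) (fun l => by
    rw [Finset.sum_filter, Fintype.sum_option]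
    cases l <;> simp [coin, w]
    ring) fun f => ind (¬ B (trueSet f))
  have hA : ∀ b : Bool, labelExp w (fun h : α → Option Bool =>
      ind (¬ A (trueSet ((fun k => decide (k = some b)) ∘ h)))) = prob (p / 2) (fun V => ¬ A V) := by
    intro b
    exact labelExp_comp (α := α) w (coin (p / 2)) (fun k => decide (k = some b)) (fun l => by
      rw [Finset.sum_filter, Fintype.sum_option]
      cases l <;> cases b <;> simp [coin, w] <;> ring) fun f => ind (¬ A (trueSet f))
  rw [two_mul]
  nth_rw 1 [← hA true]
  rw [← hA false, ← labelExp_add]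
  unfold prob
  rw [← hB]
  refine labelExp_mono hw fun f => ?_
  by_cases hf : A (trueSet ((fun k => decide (k = some true)) ∘ f)) ∧
      A (trueSet ((fun k => decide (k = some false)) ∘ f))
  · have : B (trueSet ((fun k : Option Bool => k.isSome) ∘ f)) := by
      refine h _ _ _ ?_ ?_ ?_ hf.1 hf.2
      · intro v; simp +contextual [trueSet]
      · intro v; simp +contextual [trueSet]
      · rw [Finset.disjoint_left]; intro v; simp +contextual [trueSet]
    rw [ind, if_neg (by simpa using this)]
    exact add_nonneg (ind_nonneg _) (ind_nonneg _)
  · have h3 := ind_le_one (¬ B (trueSet ((fun k : Option Bool => k.isSome) ∘ f)))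
    rw [not_and_or] at hf
    have h4 := ind_nonneg (¬ A (trueSet ((fun k => decide (k = some true)) ∘ f)))
    have h5 := ind_nonneg (¬ A (trueSet ((fun k => decide (k = some false)) ∘ f)))
    rcases hf with hf | hf
    · have : ind (¬ A (trueSet ((fun k => decide (k = some true)) ∘ f))) = 1 := by
        rw [ind, if_pos hf]
      linarith
    · have : ind (¬ A (trueSet ((fun k => decide (k = some false)) ∘ f))) = 1 := by
        rw [ind, if_pos hf]
      linarith

/-- On a finite type the measure is a sum over singletons, whose masses are the products of coin
weights in `prob`. -/
lemma one_sub_prob_le_setBernoulli (p : unitInterval) (A : Finset α → Prop) (B : Set (Set α))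
    (h : ∀ V : Finset α, A V → (V : Set α) ∈ B) :
    1 - prob p (fun V => ¬ A V) ≤ (ProbabilityTheory.setBernoulli (Set.univ : Set α) p).real B := by
  have hB : B.Finite := Set.toFinite B
  have h1 : (ProbabilityTheory.setBernoulli (Set.univ : Set α) p).real B =
      ∑ S ∈ hB.toFinset, (ProbabilityTheory.setBernoulli (Set.univ : Set α) p).real {S} := by
    rw [MeasureTheory.sum_measureReal_singleton]
    simp
  have h2 : ∑ S ∈ hB.toFinset, (ProbabilityTheory.setBernoulli (Set.univ : Set α) p).real {S} =
      prob p fun V : Finset α => (V : Set α) ∈ B := by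
    unfold prob labelExp
    simp_rw [ind, mul_ite, mul_one, mul_zero]
    rw [← Finset.sum_filter]
    refine Finset.sum_bij' (fun S _ v => decide (v ∈ S)) (fun f _ => (trueSet f : Set α))
      ?_ ?_ ?_ ?_ ?_
    · intro S hS
      simpa [trueSet] using hS
    · intro f hf
      simpa using hf
    · intro S hS
      simp [trueSet]
    · intro f hf
      simp [trueSet]
    · intro S hS
      rw [ProbabilityTheory.setBernoulli_real_singleton p (Set.subset_univ S) Set.finite_univ]
      simp only [coin, decide_eq_true_eq]
      rw [Finset.prod_ite, prod_const, prod_const, Set.ncard_eq_toFinset_card',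
        Set.ncard_eq_toFinset_card']
      congr 3
      · ext; simp
      · ext; simp
  rw [h1, h2]
  have h3 : (1 : ℝ) = labelExp (coin p) fun _ : α → Bool => 1 := (labelExp_const (sum_coin _) 1).symm
  rw [h3, sub_le_iff_le_add]
  unfold prob
  rw [← labelExp_add]
  refine labelExp_mono (coin_nonneg p.2.1 p.2.2) fun f => ?_
  by_cases hA : A (trueSet f)
  · have := h _ hA
    simp [ind, hA, this]
  · have := ind_nonneg ((trueSet f : Set α) ∈ B)
    simp [ind] at this ⊢
    simp [hA]
    split_ifs <;> simp
end RandomSubset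

/-! ### Robust neighbourhood structures in expanders. -/

section Structure

open Finset
open scoped Classical

variable {α β : Type*} [Fintype α]

/-- A maximal system of `d`-element sets `f a ⊆ nb a`, indexed by part of `P`, that covers no
element more than `M` times: few elements are covered `M` times, and these block all other
indices. -/
lemma exists_maximal_system (P : Finset β) (nb : β → Finset α) (d M : ℕ) :
    ∃ A ⊆ P, ∃ f : β → Finset α, (∀ a ∈ A, f a ⊆ nb a ∧ (f a).card = d) ∧
      (∀ z, (A.filter fun a => z ∈ f a).card ≤ M) ∧
      ∃ S : Finset α, S.card * M ≤ d * A.card ∧ ∀ b ∈ P \ A, (nb b \ S).card < d := by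
  let good : Finset β → Prop := fun A => ∃ f : β → Finset α,
    (∀ a ∈ A, f a ⊆ nb a ∧ (f a).card = d) ∧ ∀ z, (A.filter fun a => z ∈ f a).card ≤ M
  obtain ⟨A, hA, hmax⟩ := Finset.exists_max_image (P.powerset.filter good) Finset.card
    ⟨∅, by simp [good]⟩
  rw [mem_filter, mem_powerset] at hA
  obtain ⟨hAP, f, hf, hload⟩ := hA
  refine ⟨A, hAP, f, hf, hload, univ.filter fun z => (A.filter fun a => z ∈ f a).card = M, ?_, ?_⟩
  · have h1 := Finset.sum_card_bipartiteAbove_eq_sum_card_bipartiteBelow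
      (s := (univ : Finset α)) (t := A) (fun z a => z ∈ f a)
    have h2 : ∑ a ∈ A, (bipartiteBelow (fun z a => z ∈ f a) univ a).card = d * A.card := by
      rw [mul_comm, ← smul_eq_mul]
      refine Finset.sum_eq_card_nsmul fun a ha => ?_
      rw [← (hf a ha).2]
      congr 1
      ext z
      simp [bipartiteBelow]
    rw [← h2, ← h1, ← smul_eq_mul]
    refine (Finset.card_nsmul_le_sum _ (fun z => (bipartiteAbove (fun z a => z ∈ f a) A z).card)
      M fun z hz => ?_).trans (Finset.sum_le_sum_of_subset (subset_univ _))
    rw [mem_filter] at hz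
    exact hz.2.ge
  · intro b hb
    rw [mem_sdiff] at hb
    -- Otherwise `b` could be added, using `d` elements that are not yet covered `M` times.
    by_contra! hcon
    obtain ⟨t, ht, htc⟩ := Finset.exists_subset_card_eq hcon
    have hins : insert b A ∈ P.powerset.filter good := by
      rw [mem_filter, mem_powerset]
      refine ⟨insert_subset hb.1 hAP, Function.update f b t, ?_, ?_⟩
      · intro a ha
        rw [mem_insert] at ha
        by_cases hab : a = b
        · subst hab
          simpa [htc] using ht.trans sdiff_subset
        · simpa [Function.update_of_ne hab] using hf a (ha.resolve_left hab)
      · intro z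
        have heq : A.filter (fun a => z ∈ Function.update f b t a) =
            A.filter fun a => z ∈ f a := by
          refine Finset.filter_congr fun a ha => ?_
          rw [Function.update_of_ne (by rintro rfl; exact hb.2 ha)]
        rw [filter_insert, heq]
        split_ifs with hz
        · rw [Function.update_self] at hz
          have h3 := (mem_sdiff.1 (ht hz)).2
          rw [mem_filter] at h3
          have h4 := hload z
          have h5 : (A.filter fun a => z ∈ f a).card ≠ M := fun h => h3 ⟨mem_univ _, h⟩
          exact (card_insert_le _ _).trans (by omega)
        · exact hload z
    have := hmax _ hins
    rw [card_insert_of_notMem hb.2] at this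
    omega

variable {G : SimpleGraph α}

lemma mem_outerNbhd {X : Finset α} {v : α} :
    v ∈ outerNbhd G X ↔ v ∉ X ∧ ∃ u ∈ X, G.Adj u v := by
  simp [outerNbhd]

/-- A form of weak expansion with an integer parameter `l` in place of `log n`. -/
def PolyExpander (G : SimpleGraph α) (l : ℕ) : Prop :=
  ∀ (U : Finset α) (F : Finset (Sym2 α)), U.Nonempty → 3 * U.card ≤ 2 * Fintype.card α →
    (F : Set (Sym2 α)) ⊆ G.edgeSet → F.card ≤ l ^ 49 * U.card →
    U.card ≤ l ^ 3 * (outerNbhd (G.deleteEdges (F : Set (Sym2 α))) U).card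

/-- A set of an expander has either many disjoint large stars, or many outside vertices with
large sets of neighbours that overlap little. -/
lemma PolyExpander.stars_or_neighbours {l : ℕ} (hG : PolyExpander G l) (hl : 8 ≤ l)
    {U : Finset α} (hU : U.Nonempty) (hUc : 3 * U.card ≤ 2 * Fintype.card α) :
    (∃ A ⊆ U, ∃ f : α → Finset α, U.card ≤ l ^ 4 * A.card ∧
      (∀ a ∈ A, (∀ v ∈ f a, v ∉ U ∧ G.Adj a v) ∧ (f a).card = l ^ 25) ∧
      (∀ z, (A.filter fun a => z ∈ f a).card ≤ 1)) ∨
    (∃ Y ⊆ Uᶜ, ∃ g : α → Finset α, U.card ≤ l ^ 4 * Y.card ∧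
      (∀ y ∈ Y, (∀ u ∈ g y, u ∈ U ∧ G.Adj u y) ∧ (g y).card = l ^ 12) ∧
      (∀ z, (Y.filter fun y => z ∈ g y).card ≤ l ^ 12)) := by
  obtain ⟨A, hAU, f, hf, hfl, C, hC, hCmax⟩ := exists_maximal_system U
    (fun u => univ.filter fun v => v ∉ U ∧ G.Adj u v) (l ^ 25) 1
  by_cases hA : U.card ≤ l ^ 4 * A.card
  · refine Or.inl ⟨A, hAU, f, hA, fun a ha => ⟨fun v hv => ?_, (hf a ha).2⟩, hfl⟩
    simpa using (hf a ha).1 hv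
  obtain ⟨Y, hYU, g, hg, hgl, B, hB, hBmax⟩ := exists_maximal_system Uᶜ
    (fun y => (U \ A).filter fun u => G.Adj u y) (l ^ 12) (l ^ 12)
  by_cases hY : U.card ≤ l ^ 4 * Y.card
  · refine Or.inr ⟨Y, hYU, g, hY, fun a ha => ⟨fun v hv => ?_, (hg a ha).2⟩, hgl⟩
    have := (hg a ha).1 hv
    rw [mem_filter, mem_sdiff] at this
    exact ⟨this.1.1, this.2⟩
  exfalso
  push Not at hA hY
  have hl0 : 0 < l := by omega
  have hB' : B.card ≤ Y.card := by
    rw [mul_comm] at hB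
    exact Nat.le_of_mul_le_mul_left hB (by positivity)
  set U' := (U \ A) \ B with hU'
  have hU'U : U' ⊆ U := sdiff_subset.trans sdiff_subset
  have hcard : U.card ≤ U'.card + A.card + B.card := by
    have h1 := Finset.le_card_sdiff B (U \ A)
    rw [← hU'] at h1
    have h2 := Finset.le_card_sdiff A U
    omega
  have hl4 : 4096 ≤ l ^ 4 := by
    calc 4096 = 8 ^ 4 := by norm_num
      _ ≤ l ^ 4 := Nat.pow_le_pow_left hl 4
  have hA4 : 4 * A.card < U.card := lt_of_le_of_lt (Nat.mul_le_mul_right _ (by omega)) hA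
  have hY4 : 4 * Y.card < U.card := lt_of_le_of_lt (Nat.mul_le_mul_right _ (by omega)) hY
  have hU'2 : U.card ≤ 2 * U'.card := by omega
  have hUpos := hU.card_pos
  have hU'ne : U'.Nonempty := by
    rw [← Finset.card_pos]
    omega
  -- Delete all edges from `U'` that leave `U` and avoid `Y`. By maximality of the second system,
  -- each endpoint in `C` receives fewer than `l ^ 12` of them; by maximality of the first, each
  -- vertex of `U'` sends fewer than `l ^ 25` outside `C`.
  let E : Finset (α × α) := (U' ×ˢ (univ : Finset α)).filter fun e =>
    G.Adj e.1 e.2 ∧ e.2 ∉ U ∧ e.2 ∉ Y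
  let F : Finset (Sym2 α) := E.image fun e => s(e.1, e.2)
  have hE1 : (E.filter fun e => e.2 ∈ C).card ≤ l ^ 12 * C.card := by
    refine Finset.card_le_mul_card_image_of_maps_to (f := Prod.snd) (fun e he => ?_) _ ?_
    · exact (mem_filter.1 he).2
    · intro v _
      by_cases hv : v ∈ Uᶜ \ Y
      · refine le_trans ?_ (hBmax v hv).le
        refine Finset.card_le_card_of_injOn Prod.fst ?_ ?_
        · rintro ⟨a, b⟩ he
          simp only [E, coe_filter, mem_filter, mem_product, Set.mem_ofPred_eq] at he
          obtain ⟨⟨⟨⟨h1, -⟩, h2, -, -⟩, -⟩, rfl⟩ := he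
          rw [hU', mem_sdiff] at h1
          simp [h1.2, h2]
          simpa using h1.1
        · rintro ⟨a, b⟩ he ⟨a', b'⟩ he' h
          simp only [coe_filter, Set.mem_ofPred_eq] at he he'
          obtain ⟨-, rfl⟩ := he
          obtain ⟨-, rfl⟩ := he'
          simp_all
      · rw [Finset.card_eq_zero.2]
        · exact Nat.zero_le _
        · rw [Finset.filter_eq_empty_iff]
          rintro ⟨a, b⟩ he rfl
          simp only [E, mem_filter] at he
          exact hv (by simp [he.1.2.2.1, he.1.2.2.2])
  have hE2 : (E.filter fun e => e.2 ∉ C).card ≤ l ^ 25 * U'.card := by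
    refine Finset.card_le_mul_card_image_of_maps_to (f := Prod.fst) (fun e he => ?_) _ ?_
    · exact (mem_product.1 (mem_filter.1 (mem_filter.1 he).1).1).1
    · intro u hu
      rw [hU', mem_sdiff] at hu
      refine le_trans ?_ (hCmax u hu.1).le
      refine Finset.card_le_card_of_injOn Prod.snd ?_ ?_
      · rintro ⟨a, b⟩ he
        simp only [E, coe_filter, mem_filter, mem_product, Set.mem_ofPred_eq] at he
        obtain ⟨⟨⟨-, h2, h3, -⟩, h4⟩, rfl⟩ := he
        simp [h2, h3, h4]
      · rintro ⟨a, b⟩ he ⟨a', b'⟩ he' h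
        simp only [coe_filter, Set.mem_ofPred_eq] at he he'
        obtain ⟨-, rfl⟩ := he
        obtain ⟨-, rfl⟩ := he'
        simp_all
  have hF : F.card ≤ l ^ 49 * U'.card := by
    have h1 : F.card ≤ E.card := Finset.card_image_le
    have h2 := Finset.card_filter_add_card_filter_not (s := E) (fun e => e.2 ∈ C)
    have h3 : C.card ≤ l ^ 25 * U'.card := by
      have : A.card ≤ U'.card := by omega
      calc C.card ≤ l ^ 25 * A.card := by simpa using hC
        _ ≤ _ := Nat.mul_le_mul_left _ this
    calc F.card ≤ l ^ 12 * C.card + l ^ 25 * U'.card := by omega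
      _ ≤ l ^ 12 * (l ^ 25 * U'.card) + l ^ 25 * U'.card := by gcongr
      _ = (l ^ 37 + l ^ 25) * U'.card := by ring
      _ ≤ (l ^ 48 + l ^ 48) * U'.card := by
        gcongr <;> omega
      _ = 2 * l ^ 48 * U'.card := by ring
      _ ≤ l * l ^ 48 * U'.card := by gcongr; omega
      _ = _ := by ring
  have hexp := hG U' F hU'ne (by have := card_le_card hU'U; omega) ?_ hF
  · have hN : outerNbhd (G.deleteEdges (F : Set (Sym2 α))) U' ⊆ A ∪ B ∪ Y := by
      intro v hv
      rw [mem_outerNbhd] at hv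
      obtain ⟨hv, u, hu, huv⟩ := hv
      rw [SimpleGraph.deleteEdges_adj] at huv
      by_contra hcon
      simp only [mem_union, not_or] at hcon
      refine huv.2 ?_
      have hvU : v ∉ U := by
        intro hvU
        exact hv (by simp [hU', hvU, hcon.1.1, hcon.1.2])
      exact mem_image.2 ⟨(u, v), by simp [E, hu, huv.1, hvU, hcon.2], rfl⟩
    have hN' : (outerNbhd (G.deleteEdges (F : Set (Sym2 α))) U').card ≤
        A.card + B.card + Y.card :=
      (card_le_card hN).trans ((card_union_le _ _).trans (by gcongr; exact card_union_le _ _))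
    -- All of `A`, `B`, `Y` have size below `|U| / l ^ 4`, so expansion makes `U'` smaller than half
    -- of `U`, against `hU'2`.
    have h8 : 8 * U'.card ≤ 3 * U.card := by
      calc 8 * U'.card ≤ l * U'.card := by gcongr
        _ ≤ l * (l ^ 3 * (A.card + B.card + Y.card)) := by
            gcongr
            exact hexp.trans (by gcongr)
        _ ≤ l * (l ^ 3 * (A.card + Y.card + Y.card)) := by gcongr
        _ = l ^ 4 * A.card + l ^ 4 * Y.card + l ^ 4 * Y.card := by ring
        _ ≤ _ := by omega
    omega
  · intro e he
    simp only [F, coe_image, Set.mem_image, mem_coe] at he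
    obtain ⟨⟨a, b⟩, h, rfl⟩ := he
    simp only [E, mem_filter] at h
    exact h.2.1

end Structure

/-! ### Neighbours of a random part of a set. -/

section OneRound

open Finset
open scoped Classical

variable {α β : Type*} [Fintype α]

lemma card_small_subsets_le (b : ℕ) :
    ((univ : Finset (Finset α)).filter fun T => T.card ≤ b).card ≤ (Fintype.card α + 1) ^ b := by
  induction b with
  | zero =>
    have : ((univ : Finset (Finset α)).filter fun T => T.card ≤ 0) = {∅} := by ext; simp
    rw [this]
    simp
  | succ b ih =>
    have hsub : ((univ : Finset (Finset α)).filter fun T => T.card ≤ b + 1) ⊆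
        (((univ : Finset (Finset α)).filter fun T => T.card ≤ b) ×ˢ
          (univ : Finset (Option α))).image fun e => e.2.elim e.1 fun a => insert a e.1 := by
      intro T hT
      rw [mem_filter] at hT
      rw [mem_image]
      rcases T.eq_empty_or_nonempty with rfl | ⟨a, ha⟩
      · exact ⟨(∅, none), by simp, rfl⟩
      · refine ⟨(T.erase a, some a), ?_, ?_⟩
        · simp [card_erase_of_mem ha]
          omega
        · simp [insert_erase ha]
    refine (card_le_card hsub).trans (card_image_le.trans ?_)
    rw [card_product, pow_succ]
    simp only [card_univ, Fintype.card_option]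
    gcongr

/-- Bookkeeping for union bounds: `2 ^ x` events of probability `2 ^ (-m)`. -/
lemma mul_half_pow_le {N : ℝ} {x m g : ℕ} (hN : N ≤ 2 ^ x) (h : x + g ≤ m) :
    N * (1 / 2) ^ m ≤ (1 / 2) ^ g := by
  calc N * (1 / 2) ^ m ≤ 2 ^ x * (1 / 2) ^ (x + g) := by
        refine mul_le_mul hN ?_ (by positivity) (by positivity)
        exact pow_le_pow_of_le_one (by norm_num) (by norm_num) h
    _ = (1 / 2) ^ g := by
        rw [pow_add, ← mul_assoc, ← mul_pow]
        norm_num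

variable {p : ℝ} {l : ℕ}

/-- A random set misses many elements of a fixed set with small probability. -/
lemma prob_card_inter_le_le (h0 : 0 ≤ p) (h1 : p ≤ 1) {N m b x g : ℕ}
    (hN : (1 - p) ^ N ≤ 1 / 2) (hx : Fintype.card α + 1 ≤ 2 ^ x) (A : Finset α)
    (hA : N * m + b ≤ A.card) (hm : x * b + g ≤ m) :
    prob p (fun V => (A ∩ V).card ≤ b) ≤ (1 / 2) ^ g := by
  -- If `A ∩ V = T` is small, then `V` misses all of `A \ T`; the union bound runs over `T`.
  let 𝓕 : Finset (Finset α) := ((univ : Finset (Finset α)).filter fun T => T.card ≤ b).image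
    fun T => A \ T
  have h𝓕 : ∀ S ∈ 𝓕, N * m ≤ S.card := by
    intro S hS
    obtain ⟨T, hT, rfl⟩ := mem_image.1 hS
    rw [mem_filter] at hT
    have := le_card_sdiff T A
    omega
  refine (prob_mono h0 h1 (B := fun V => ∃ S ∈ 𝓕, Disjoint S V) ?_).trans
    ((prob_exists_disjoint_le h0 h1 hN 𝓕 h𝓕).trans (mul_half_pow_le (x := x * b) ?_ hm))
  · intro V hV
    refine ⟨A \ (A ∩ V), mem_image.2 ⟨A ∩ V, by simpa using hV, rfl⟩, ?_⟩
    rw [Finset.disjoint_left]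
    intro v hv hv'
    simp_all
  · rw [pow_mul]
    have : 𝓕.card ≤ (2 ^ x) ^ b :=
      card_image_le.trans ((card_small_subsets_le b).trans (Nat.pow_le_pow_left hx b))
    exact_mod_cast this

/-- Take a maximal disjoint subfamily: every set meets its union, which has at most `d * T.card`
elements, each in at most `M` sets. -/
lemma exists_disjoint_subfamily {γ : Type*} {Y : Finset β} {s : β → Finset γ} {d M : ℕ}
    (hs : ∀ y ∈ Y, (s y).card = d) (hd : 0 < d)
    (hM : ∀ z, (Y.filter fun y => z ∈ s y).card ≤ M) :
    ∃ T ⊆ Y, (T : Set β).PairwiseDisjoint s ∧ Y.card ≤ M * d * T.card := by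
  obtain ⟨T, hT, hmax⟩ := Finset.exists_max_image
    (Y.powerset.filter fun T : Finset β => (T : Set β).PairwiseDisjoint s) Finset.card ⟨∅, by simp⟩
  rw [mem_filter, mem_powerset] at hT
  refine ⟨T, hT.1, hT.2, ?_⟩
  have hmeet : ∀ y ∈ Y, ∃ z ∈ T.biUnion s, z ∈ s y := by
    intro y hy
    by_contra! hcon
    have hyT : y ∉ T := by
      intro hyT
      obtain ⟨z, hz⟩ := Finset.card_pos.1 (by rw [hs y hy]; exact hd)
      exact hcon z (mem_biUnion.2 ⟨y, hyT, hz⟩) hz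
    have := hmax (insert y T) (by
      rw [mem_filter, mem_powerset]
      refine ⟨insert_subset hy hT.1, ?_⟩
      rw [coe_insert]
      refine hT.2.insert fun j hj _ => ?_
      refine Finset.disjoint_left.2 fun z hz hz' => hcon z (mem_biUnion.2 ⟨j, hj, hz'⟩) hz)
    rw [card_insert_of_notMem hyT] at this
    omega
  rcases Y.eq_empty_or_nonempty with rfl | ⟨y₀, hy₀⟩
  · simp
  have : Nonempty γ := ⟨(hmeet y₀ hy₀).choose⟩
  choose! z hz hzs using hmeet
  calc Y.card ≤ M * (T.biUnion s).card := by
        refine Finset.card_le_mul_card_image_of_maps_to (f := z) hz _ fun v _ => ?_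
        refine (card_le_card fun y hy => ?_).trans (hM v)
        rw [mem_filter] at hy ⊢
        exact ⟨hy.1, hy.2 ▸ hzs y hy.1⟩
    _ ≤ M * (T.card * d) := by
        gcongr
        exact card_biUnion_le_card_mul _ _ _ fun y hy => (hs y (hT.1 hy)).le
    _ = _ := by ring

/-- For a family of sets with little overlap, it is unlikely that a random set misses many of
them. -/
lemma prob_card_missed_le (h0 : 0 ≤ p) (h1 : p ≤ 1) {N m d M x g k : ℕ}
    (hN : (1 - p) ^ N ≤ 1 / 2) (hx : Fintype.card α + 1 ≤ 2 ^ x) (Y : Finset α) (s : α → Finset α)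
    (hs : ∀ y ∈ Y, (s y).card = d) (hM : ∀ z, (Y.filter fun y => z ∈ s y).card ≤ M)
    (hd : 0 < d) (hM0 : 0 < M) (hk : M * d * g ≤ k) (hm : N * m ≤ g * d)
    (hxm : x * g + g ≤ m) :
    prob p (fun V => k ≤ (Y.filter fun y => Disjoint (s y) V).card) ≤ (1 / 2) ^ g := by
  let 𝓣 : Finset (Finset α) := (univ : Finset (Finset α)).filter fun T =>
    T.card = g ∧ T ⊆ Y ∧ (T : Set α).PairwiseDisjoint s
  let 𝓕 : Finset (Finset α) := 𝓣.image fun T => T.biUnion s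
  have h𝓕 : ∀ S ∈ 𝓕, N * m ≤ S.card := by
    intro S hS
    obtain ⟨T, hT, rfl⟩ := mem_image.1 hS
    obtain ⟨-, hTg, hTY, hTd⟩ := mem_filter.1 hT
    rw [card_biUnion fun a ha b hb hab => hTd ha hb hab,
      Finset.sum_congr rfl fun y hy => hs y (hTY hy), sum_const, hTg]
    exact hm
  refine (prob_mono h0 h1 (B := fun V => ∃ S ∈ 𝓕, Disjoint S V) ?_).trans
    ((prob_exists_disjoint_le h0 h1 hN 𝓕 h𝓕).trans (mul_half_pow_le (x := x * g) ?_ hxm))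
  · intro V hV
    obtain ⟨T, hTY, hTd, hTc⟩ := exists_disjoint_subfamily
      (Y := Y.filter fun y => Disjoint (s y) V) (s := s) (d := d) (M := M)
      (fun y hy => hs y (mem_filter.1 hy).1) hd
      (fun z => (card_le_card (filter_subset_filter _ (filter_subset _ _))).trans (hM z))
    have hg : g ≤ T.card := Nat.le_of_mul_le_mul_left (hk.trans (hV.trans hTc)) (by positivity)
    obtain ⟨T', hT', hT'c⟩ := exists_subset_card_eq hg
    refine ⟨T'.biUnion s, mem_image.2 ⟨T', ?_, rfl⟩, ?_⟩
    · simp only [𝓣, mem_filter, mem_univ, true_and]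
      exact ⟨hT'c, (hT'.trans hTY).trans (filter_subset _ _),
        hTd.subset (by exact_mod_cast hT')⟩
    · rw [disjoint_biUnion_left]
      exact fun y hy => (mem_filter.1 (hTY (hT' hy))).2
  · rw [pow_mul]
    have : 𝓕.card ≤ (2 ^ x) ^ g := by
      refine card_image_le.trans (le_trans (card_le_card ?_)
        ((card_small_subsets_le (α := α) g).trans (Nat.pow_le_pow_left hx g)))
      intro T hT
      simp only [𝓣, mem_filter] at hT
      simp [hT.2.1.le]
    exact_mod_cast this

variable {G : SimpleGraph α}

/-- In an expander, a random subset of a large set `U` is likely to have many neighbours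
outside `U`. -/
lemma PolyExpander.prob_few_neighbours_le (hG : PolyExpander G l) (hl : 8 ≤ l)
    (hn : Fintype.card α + 1 ≤ 2 ^ l) (h0 : 0 ≤ p) (h1 : p ≤ 1)
    (hp : (1 - p) ^ (l ^ 10) ≤ 1 / 2) {U : Finset α} (hUc : 3 * U.card ≤ 2 * Fintype.card α)
    {k : ℕ} (hk : 0 < k) (hkU : k * l ^ 30 ≤ U.card) :
    prob p (fun V => l ^ 5 * (outerNbhd G (U ∩ V) \ U).card < U.card) ≤ (1 / 2) ^ k := by
  have hl0 : 0 < l := by omega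
  have hU : U.Nonempty := by
    rw [← card_pos]
    exact lt_of_lt_of_le (by positivity) hkU
  -- Both cases need a parameter comparable with `|U| / l ^ 30`, whereas `k` is only a lower bound
  -- for it.
  obtain ⟨g, hkg, hgU, hUg⟩ : ∃ g, k ≤ g ∧ g * l ^ 30 ≤ U.card ∧ U.card < (g + 1) * l ^ 30 := by
    refine ⟨U.card / l ^ 30, ?_, Nat.div_mul_le_self _ _, ?_⟩
    · rwa [Nat.le_div_iff_mul_le (by positivity)]
    · rw [mul_comm]
      exact Nat.lt_mul_div_succ _ (by positivity)
  refine le_trans ?_ (pow_le_pow_of_le_one (by norm_num) (by norm_num) hkg)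
  have hg : 0 < g := by omega
  have hUg' : U.card < g * l ^ 31 := by
    calc U.card < (g + 1) * l ^ 30 := hUg
      _ ≤ (g * l) * l ^ 30 := by gcongr; nlinarith
      _ = _ := by ring
  rcases hG.stars_or_neighbours hl hU hUc with ⟨A, hAU, f, hA, hf, hfl⟩ | ⟨Y, hYU, s, hY, hs, hsl⟩
  · refine (prob_mono h0 h1 (B := fun V => (A ∩ V).card ≤ g * l) ?_).trans
      (prob_card_inter_le_le h0 h1 (m := g * l ^ 15) hp hn A ?_ ?_)
    · intro V hV
      by_contra! hcon
      have hsub : (A ∩ V).biUnion f ⊆ outerNbhd G (U ∩ V) \ U := by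
        intro v hv
        obtain ⟨a, ha, hv⟩ := mem_biUnion.1 hv
        rw [mem_inter] at ha
        have := (hf a ha.1).1 v hv
        rw [mem_sdiff, mem_outerNbhd]
        exact ⟨⟨by simp [this.1], a, by simp [hAU ha.1, ha.2], this.2⟩, this.1⟩
      have hdis : (A ∩ V).card * l ^ 25 = ((A ∩ V).biUnion f).card := by
        rw [card_biUnion, Finset.sum_congr rfl fun a ha => (hf a (mem_inter.1 ha).1).2, sum_const,
          smul_eq_mul]
        intro a ha b hb hab
        rw [Function.onFun, Finset.disjoint_left]
        intro z hza hzb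
        refine hab (Finset.card_le_one.1 (hfl z) a ?_ b ?_)
        · exact mem_filter.2 ⟨(mem_inter.1 ha).1, hza⟩
        · exact mem_filter.2 ⟨(mem_inter.1 hb).1, hzb⟩
      have := card_le_card hsub
      rw [← hdis] at this
      have h2 : g * l ^ 31 ≤ l ^ 5 * (outerNbhd G (U ∩ V) \ U).card := by
        calc g * l ^ 31 = l ^ 5 * ((g * l) * l ^ 25) := by ring
          _ ≤ l ^ 5 * ((A ∩ V).card * l ^ 25) := by gcongr
          _ ≤ _ := by gcongr
      omega
    · have h3 : g * l ^ 26 ≤ A.card := by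
        refine le_of_mul_le_mul_left (a := l ^ 4) ?_ (by positivity)
        calc l ^ 4 * (g * l ^ 26) = g * l ^ 30 := by ring
          _ ≤ _ := hgU.trans hA
      refine le_trans ?_ h3
      calc l ^ 10 * (g * l ^ 15) + g * l = g * (l ^ 25 + l ^ 1) := by ring
        _ ≤ g * (l ^ 25 + l ^ 25) := by gcongr; omega
        _ = g * (2 * l ^ 25) := by ring
        _ ≤ g * (l * l ^ 25) := by gcongr; omega
        _ = _ := by ring
    · calc l * (g * l) + g = g * (l ^ 2 + l ^ 0) := by ring
        _ ≤ g * (l ^ 14 + l ^ 14) := by gcongr <;> omega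
        _ = g * (2 * l ^ 14) := by ring
        _ ≤ g * (l * l ^ 14) := by gcongr; omega
        _ = _ := by ring
  · refine (prob_mono h0 h1
      (B := fun V => g * l ^ 25 ≤ (Y.filter fun y => Disjoint (s y) V).card) ?_).trans
      (prob_card_missed_le h0 h1 (m := g * l ^ 2) (d := l ^ 12) (M := l ^ 12) hp hn Y s
        (fun y hy => (hs y hy).2) hsl (by positivity) (by positivity) ?_ ?_ ?_)
    · intro V hV
      -- A vertex of `Y` is lost only if `V` misses its whole set `s y`. At most `g * l ^ 25` losses
      -- are affordable, as `l ^ 5 * |Y|` is at least `2 * |U|`.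
      have hsub : Y.filter (fun y => ¬ Disjoint (s y) V) ⊆ outerNbhd G (U ∩ V) \ U := by
        intro y hy
        rw [mem_filter, Finset.not_disjoint_iff] at hy
        obtain ⟨hyY, z, hz, hzV⟩ := hy
        have := (hs y hyY).1 z hz
        have hyU := hYU hyY
        rw [mem_compl] at hyU
        rw [mem_sdiff, mem_outerNbhd]
        exact ⟨⟨by simp [hyU], z, by simp [this.1, hzV], this.2⟩, hyU⟩
      have h3 := card_le_card hsub
      have h4 := Finset.card_filter_add_card_filter_not (s := Y) (fun y => Disjoint (s y) V)
      refine le_of_mul_le_mul_left (a := l ^ 5) ?_ (by positivity)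
      have h5 : l ^ 5 * (Y.filter fun y => ¬ Disjoint (s y) V).card < U.card :=
        lt_of_le_of_lt (Nat.mul_le_mul_left _ h3) hV
      have h6 : 2 * U.card ≤ l ^ 5 * Y.card := by
        calc 2 * U.card ≤ l * U.card := by gcongr; omega
          _ ≤ l * (l ^ 4 * Y.card) := by gcongr
          _ = _ := by ring
      rw [← h4, mul_add] at h6
      calc l ^ 5 * (g * l ^ 25) = g * l ^ 30 := by ring
        _ ≤ U.card := hgU
        _ ≤ _ := by omega
    · calc l ^ 12 * l ^ 12 * g = g * l ^ 24 := by ring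
        _ ≤ _ := by gcongr; omega
    · exact le_of_eq (by ring)
    · calc l * g + g = g * (l + 1) := by ring
        _ ≤ g * (l ^ 2) := by gcongr; nlinarith
end OneRound

/-! ### Growing the set reached through a random set. -/

section Reach

open Finset
open scoped Classical

variable {α : Type*} [Fintype α] {G : SimpleGraph α}

/-- The vertices that can be reached from `Z` by a walk of length at most `m`, all vertices of
which except for the last one belong to `S`. -/
noncomputable def reach (G : SimpleGraph α) (S : Finset α) : ℕ → Finset α → Finset α
  | 0, Z => Z
  | m + 1, Z => reach G S m Z ∪ outerNbhd G (reach G S m Z ∩ S)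

lemma mem_reach_succ {S Z : Finset α} {m : ℕ} {v : α} :
    v ∈ reach G S (m + 1) Z ↔ v ∈ reach G S m Z ∨ ∃ u ∈ reach G S m Z, u ∈ S ∧ G.Adj u v := by
  rw [reach, mem_union, mem_outerNbhd]
  simp only [mem_inter]
  constructor
  · rintro (h | ⟨-, u, ⟨h1, h2⟩, h3⟩)
    · exact Or.inl h
    · exact Or.inr ⟨u, h1, h2, h3⟩
  · rintro (h | ⟨u, h1, h2, h3⟩)
    · exact Or.inl h
    · by_cases hv : v ∈ reach G S m Z
      · exact Or.inl hv
      · exact Or.inr ⟨fun h => hv h.1, u, ⟨h1, h2⟩, h3⟩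

lemma reach_mono {S S' Z Z' : Finset α} (hS : S ⊆ S') (hZ : Z ⊆ Z') (m : ℕ) :
    reach G S m Z ⊆ reach G S' m Z' := by
  induction m with
  | zero => exact hZ
  | succ m ih =>
    intro v hv
    rw [mem_reach_succ] at hv ⊢
    rcases hv with h | ⟨u, h1, h2, h3⟩
    · exact Or.inl (ih h)
    · exact Or.inr ⟨u, ih h1, hS h2, h3⟩

lemma reach_add (S Z : Finset α) (a b : ℕ) :
    reach G S (a + b) Z = reach G S b (reach G S a Z) := by
  induction b with
  | zero => rfl
  | succ b ih => rw [← add_assoc, reach, reach, ih]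

lemma reach_union (S Z Z' : Finset α) (m : ℕ) :
    reach G S m (Z ∪ Z') = reach G S m Z ∪ reach G S m Z' := by
  induction m with
  | zero => rfl
  | succ m ih =>
    ext v
    rw [mem_union, mem_reach_succ, mem_reach_succ, mem_reach_succ, ih]
    simp only [mem_union]
    grind

lemma reach_empty (S : Finset α) (m : ℕ) : reach G S m ∅ = ∅ := by
  induction m with
  | zero => rfl
  | succ m ih =>
    ext v
    simp [mem_reach_succ, ih]

/-- The closed neighbourhood of a set of vertices. -/
noncomputable def closedNbhd (G : SimpleGraph α) (X : Finset α) : Finset α := X ∪ outerNbhd G X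

lemma mem_closedNbhd {X : Finset α} {v : α} :
    v ∈ closedNbhd G X ↔ v ∈ X ∨ ∃ u ∈ X, G.Adj u v := by
  rw [closedNbhd, mem_union, mem_outerNbhd]
  tauto

lemma closedNbhd_union (X X' : Finset α) :
    closedNbhd G (X ∪ X') = closedNbhd G X ∪ closedNbhd G X' := by
  ext v
  simp only [mem_union, mem_closedNbhd]
  grind

/-- Starting from the closed neighbourhood exempts `x` itself from lying in `S`. -/
lemma exists_walk_of_mem_reach {S : Finset α} {x : α} (m : ℕ) :
    ∀ v ∈ reach G S m (closedNbhd G {x}), ∃ p : G.Walk x v, p.length ≤ m + 1 ∧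
      ∀ w ∈ p.support, w ≠ x → w ≠ v → w ∈ S := by
  induction m with
  | zero =>
    intro v hv
    rw [reach, mem_closedNbhd] at hv
    rcases hv with hv | ⟨u, hu, huv⟩
    · rw [mem_singleton] at hv
      subst hv
      exact ⟨.nil, by simp, by simp +contextual⟩
    · rw [mem_singleton] at hu
      subst hu
      exact ⟨.cons huv .nil, by simp, by simp +contextual⟩
  | succ m ih =>
    intro v hv
    rw [mem_reach_succ] at hv
    rcases hv with hv | ⟨u, hu, huS, huv⟩
    · obtain ⟨p, hp, hpS⟩ := ih v hv
      exact ⟨p, by omega, hpS⟩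
    · obtain ⟨p, hp, hpS⟩ := ih u hu
      refine ⟨p.concat huv, by simpa using hp, fun w hw hwx hwv => ?_⟩
      rw [SimpleGraph.Walk.support_concat, List.mem_append, List.mem_singleton] at hw
      by_cases hwu : w = u
      · exact hwu ▸ huS
      · exact hpS w (hw.resolve_right hwv) hwx hwu

lemma exists_path_of_mem_reach {S S' : Finset α} {x y z : α} {m : ℕ} (hS : S ⊆ S')
    (hx : z ∈ reach G S m (closedNbhd G {x})) (hy : z ∈ reach G S m (closedNbhd G {y}))
    (hz : z ∈ S') :
    ∃ P : G.Path x y, ∃ F : Finset α, pathInterior P = F ∧ F ⊆ S' ∧ F.card ≤ 2 * m + 3 := by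
  obtain ⟨p, hp, hpS⟩ := exists_walk_of_mem_reach m z hx
  obtain ⟨q, hq, hqS⟩ := exists_walk_of_mem_reach m z hy
  let w : G.Walk x y := p.append q.reverse
  have hw : ∀ v ∈ w.support, v ≠ x → v ≠ y → v ∈ S' := by
    intro v hv hvx hvy
    by_cases hvz : v = z
    · exact hvz ▸ hz
    rw [SimpleGraph.Walk.mem_support_append_iff, SimpleGraph.Walk.support_reverse,
      List.mem_reverse] at hv
    rcases hv with hv | hv
    · exact hS (hpS v hv hvx hvz)
    · exact hS (hqS v hv hvy hvz)
  refine ⟨w.toPath, (pathInterior w.toPath).toFinset, by simp, ?_, ?_⟩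
  · intro v hv
    rw [Set.mem_toFinset] at hv
    exact hw v (SimpleGraph.Walk.support_toPath_subset_support w hv.1) hv.2.1 hv.2.2
  · have h1 : (pathInterior w.toPath).toFinset ⊆ w.toPath.1.support.toFinset := by
      intro v hv
      rw [Set.mem_toFinset] at hv
      exact List.mem_toFinset.2 hv.1
    have h2 : w.toPath.1.support.length = w.toPath.1.length + 1 :=
      SimpleGraph.Walk.length_support _
    have h3 : w.toPath.1.length ≤ w.length := SimpleGraph.Walk.length_bypass_le_length w
    have h4 : w.length = p.length + q.length := by simp [w]
    have h5 := (card_le_card h1).trans (List.toFinset_card_le _)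
    omega

variable {p : ℝ} {l : ℕ}

/-- In an expander, the set of vertices reached from a large set through a random set grows to
more than half of the vertices. -/
lemma PolyExpander.prob_reach_small_le (hG : PolyExpander G l) (hl : 8 ≤ l)
    (hn : Fintype.card α + 1 ≤ 2 ^ l) (h0 : 0 < p) (hp : (1 - p) ^ (l ^ 10) ≤ 1 / 2)
    {Z W : Finset α} {g k : ℕ} (hk : 0 < k) (hkg : k * l ^ 30 ≤ g) (hgW : 2 * l ^ 5 * W.card ≤ g)
    (hgZ : g ≤ (Z \ W).card) {c : ℝ} (hc : l ^ 7 * p ≤ c) (hc1 : c ≤ 1) :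
    prob c (fun V => ¬ 3 * Fintype.card α ≤ 5 * (reach G (V \ W) (l ^ 7) Z \ W).card) ≤
      l ^ 7 * (1 / 2) ^ k := by
  have hl0 : (0 : ℝ) < l := by
    have : 0 < l := by omega
    exact_mod_cast this
  have hl1 : (8 : ℝ) ≤ l := by exact_mod_cast hl
  -- Growth is demanded only below 3n/5, which leaves room under the bound 2n/3 in the expansion
  -- hypothesis.
  let Q : ℕ → Finset α → Prop := fun t V =>
    3 * Fintype.card α ≤ 5 * (reach G (V \ W) t Z \ W).card ∨
      g * (1 + 1 / (l : ℝ) ^ 6) ^ t ≤ ((reach G (V \ W) t Z \ W).card : ℝ)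
  have hiter := prob_not_iterate_le (q := (1 / 2) ^ k) h0 (by positivity) Q
    (fun V => Or.inr (by simpa [reach] using hgZ)) (l ^ 7) ?_ c (by exact_mod_cast hc) hc1
  · refine (prob_mono (le_trans (by positivity) hc) hc1 ?_).trans
      (hiter.trans (le_of_eq (by push_cast; ring)))
    intro V hV hQ
    refine hV (hQ.resolve_right fun h => ?_)
    -- By Bernoulli's inequality, `l ^ 6` rounds double the set, so `l ^ 7` rounds would exceed `n`.
    have h1 : (2 : ℝ) ^ l ≤ (1 + 1 / (l : ℝ) ^ 6) ^ (l ^ 7) := by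
      have h2 : (2 : ℝ) ≤ (1 + 1 / (l : ℝ) ^ 6) ^ (l ^ 6) := by
        have := one_add_mul_le_pow (a := 1 / (l : ℝ) ^ 6)
          (le_trans (by norm_num) (by positivity : (0 : ℝ) ≤ 1 / (l : ℝ) ^ 6)) (l ^ 6)
        push_cast at this
        rw [mul_one_div_cancel (by positivity)] at this
        linarith
      calc (2 : ℝ) ^ l ≤ ((1 + 1 / (l : ℝ) ^ 6) ^ (l ^ 6)) ^ l :=
            pow_le_pow_left₀ (by norm_num) h2 _
        _ = _ := by rw [← pow_mul, ← pow_succ]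
    have hg1 : (1 : ℝ) ≤ g := by
      have : 0 < k * l ^ 30 := Nat.mul_pos hk (Nat.pow_pos (by omega))
      exact_mod_cast (by omega : 1 ≤ g)
    have h3 : (Fintype.card α : ℝ) + 1 ≤ 2 ^ l := by exact_mod_cast hn
    have h4 : ((reach G (V \ W) (l ^ 7) Z \ W).card : ℝ) ≤ Fintype.card α := by
      exact_mod_cast card_le_univ _
    nlinarith
  · intro t _ U hU b hb hb1
    have hb0 : 0 ≤ b := h0.le.trans hb
    have hbN : (1 - b) ^ (l ^ 10) ≤ 1 / 2 :=
      (pow_le_pow_left₀ (by linarith) (by linarith) _).trans hp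
    set R := reach G (U \ W) t Z with hR
    have hmono : ∀ V : Finset α, R ⊆ reach G ((U ∪ V) \ W) t Z := fun V =>
      reach_mono (sdiff_subset_sdiff subset_union_left subset_rfl) subset_rfl t
    have hmono' : ∀ V : Finset α, R ⊆ reach G ((U ∪ V) \ W) (t + 1) Z := fun V =>
      (hmono V).trans fun v hv => mem_reach_succ.2 (Or.inl hv)
    by_cases hbig : 3 * Fintype.card α ≤ 5 * (R \ W).card
    · have : (fun V : Finset α => ¬ Q (t + 1) (U ∪ V)) = fun _ => False := by
        funext V
        rw [eq_iff_iff, iff_false, not_not]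
        have := card_le_card (sdiff_subset_sdiff (hmono' V) (subset_refl W))
        exact Or.inl (by omega)
      rw [this, prob_false]
      positivity
    have hUg := hU.resolve_left hbig
    rw [← hR] at hUg
    have hone : (1 : ℝ) ≤ (1 + 1 / (l : ℝ) ^ 6) ^ t :=
      one_le_pow₀ (by have : (0 : ℝ) ≤ 1 / (l : ℝ) ^ 6 := by positivity
                      linarith)
    have hgR : g ≤ (R \ W).card := by
      have : (g : ℝ) ≤ (R \ W).card := le_trans (le_mul_of_one_le_right (by positivity) hone) hUg
      exact_mod_cast this
    refine le_trans (prob_mono hb0 hb1 ?_) (hG.prob_few_neighbours_le hl hn hb0 hb1 hbN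
      (U := R \ W) (by omega) hk (hkg.trans hgR))
    intro V hV
    by_contra! hcon
    refine hV (Or.inr ?_)
    set N := outerNbhd G ((R \ W) ∩ V) \ (R \ W) with hN
    have hsub : (R \ W) ∪ (N \ W) ⊆ reach G ((U ∪ V) \ W) (t + 1) Z \ W := by
      intro v hv
      rw [mem_union, mem_sdiff, mem_sdiff] at hv
      rw [mem_sdiff]
      rcases hv with hv | hv
      · exact ⟨hmono' V hv.1, hv.2⟩
      · refine ⟨?_, hv.2⟩
        have hv1 := hv.1
        rw [hN, mem_sdiff, mem_outerNbhd] at hv1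
        obtain ⟨⟨-, u, hu, huv⟩, -⟩ := hv1
        rw [mem_inter, mem_sdiff] at hu
        exact mem_reach_succ.2 (Or.inr ⟨u, hmono V hu.1.1, by simp [hu.1.2, hu.2], huv⟩)
    have hcard := card_le_card hsub
    have hdisj : Disjoint (R \ W) (N \ W) :=
      Finset.disjoint_left.2 fun v h1 h2 => (mem_sdiff.1 (mem_sdiff.1 h2).1).2 h1
    rw [card_union_of_disjoint hdisj] at hcard
    have hNW : N.card ≤ (N \ W).card + W.card := by
      have := le_card_sdiff W N
      omega
    have e1 : ((R \ W).card : ℝ) ≤ (l : ℝ) ^ 5 * N.card := by exact_mod_cast hcon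
    have e2 : ((R \ W).card : ℝ) + N.card - W.card ≤
        ((reach G ((U ∪ V) \ W) (t + 1) Z \ W).card : ℝ) := by
      have : (R \ W).card + N.card ≤
        (reach G ((U ∪ V) \ W) (t + 1) Z \ W).card + W.card := by omega
      have : ((R \ W).card : ℝ) + N.card ≤
        (reach G ((U ∪ V) \ W) (t + 1) Z \ W).card + W.card := by exact_mod_cast this
      linarith
    have e3 : 2 * (l : ℝ) ^ 5 * W.card ≤ (R \ W).card := by exact_mod_cast hgW.trans hgR
    -- There are at least `|R \ W| / l ^ 5` new vertices, and `W` takes away at most half of that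
    -- amount.
    have e4 : ((R \ W).card : ℝ) * (1 / (l : ℝ) ^ 6) ≤ N.card - W.card := by
      rw [mul_one_div, div_le_iff₀ (by positivity)]
      have e5 : ((R \ W).card : ℝ) ≤ 2 * ((l : ℝ) ^ 5 * (N.card - W.card)) := by nlinarith
      have e6 : (0 : ℝ) ≤ (l : ℝ) ^ 5 * (N.card - W.card) := by
        have : (0 : ℝ) ≤ ((R \ W).card : ℝ) := by positivity
        linarith
      calc ((R \ W).card : ℝ) ≤ 2 * ((l : ℝ) ^ 5 * (N.card - W.card)) := e5
        _ ≤ l * ((l : ℝ) ^ 5 * (N.card - W.card)) := by gcongr; linarith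
        _ = _ := by ring
    calc (g : ℝ) * (1 + 1 / (l : ℝ) ^ 6) ^ (t + 1)
        = (g * (1 + 1 / (l : ℝ) ^ 6) ^ t) * (1 + 1 / (l : ℝ) ^ 6) := by ring
      _ ≤ (R \ W).card * (1 + 1 / (l : ℝ) ^ 6) := by gcongr
      _ ≤ _ := by linarith

lemma exists_union_halves {β : Type*} (X : Finset β) :
    ∃ X₁ X₂ : Finset β, X₁ ∪ X₂ = X ∧ 2 * X₁.card ≤ X.card + 1 ∧ 2 * X₂.card ≤ X.card + 1 := by
  obtain ⟨X₁, h, hc⟩ := exists_subset_card_eq (Nat.div_le_self X.card 2)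
  refine ⟨X₁, X \ X₁, union_sdiff_of_subset h, by omega, ?_⟩
  rw [card_sdiff_of_subset h]
  omega

/-- Some vertex of a well-expanding set reaches more than half of the vertices through a random
set. -/
lemma PolyExpander.prob_no_vertex_reaches_le (hG : PolyExpander G l) (hl : 8 ≤ l)
    (hn : Fintype.card α + 1 ≤ 2 ^ l) (h0 : 0 < p) (hp : (1 - p) ^ (l ^ 10) ≤ 1 / 2)
    {X W : Finset α} (hX : X.Nonempty) (hXN : X.card * l ^ 49 ≤ (outerNbhd G X).card)
    (hW : W.card ≤ l ^ 10 * X.card) {c : ℝ} (hc : (l + 1) * (l ^ 7 * p) ≤ c) (hc1 : c ≤ 1) :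
    prob c (fun V => ¬ ∃ x ∈ X, 3 * Fintype.card α ≤
      5 * (reach G (V \ W) ((l + 1) * l ^ 7) (closedNbhd G {x}) \ W).card) ≤
      (l + 1) * (l ^ 7 * (1 / 2) ^ (X.card * l ^ 18)) := by
  have hl0 : 0 < l := by omega
  have hXpos := hX.card_pos
  have hk : 0 < X.card * l ^ 18 := by positivity
  have hkg : X.card * l ^ 18 * l ^ 30 ≤ X.card * l ^ 48 := le_of_eq (by ring)
  have hpw : ∀ a b : ℕ, a ≤ b → l ^ a ≤ l ^ b := fun a b h => Nat.pow_le_pow_right hl0 h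
  have hgW : 2 * l ^ 5 * W.card ≤ X.card * l ^ 48 := by
    calc 2 * l ^ 5 * W.card ≤ l * l ^ 5 * (l ^ 10 * X.card) := by gcongr; omega
      _ = X.card * l ^ 16 := by ring
      _ ≤ _ := Nat.mul_le_mul_left _ (hpw _ _ (by omega))
  have hXn : X.card * l ^ 49 ≤ Fintype.card α := hXN.trans (card_le_univ _)
  -- After `i` halvings, with rounding up, the current `X'` has at most `|X| / 2 ^ i + 1` elements;
  -- since `|X| < 2 ^ l`, it is a singleton when `i = l`.
  let Q : ℕ → Finset α → Prop := fun t V => t = 0 ∨ ∃ i, t = i + 1 ∧ ∃ X' ⊆ X, X'.Nonempty ∧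
    2 ^ i * X'.card ≤ X.card + 2 ^ i ∧
    3 * Fintype.card α ≤ 5 * (reach G (V \ W) ((i + 1) * l ^ 7) (closedNbhd G X') \ W).card
  have hiter := prob_not_iterate_le (p := l ^ 7 * p) (q := l ^ 7 * (1 / 2) ^ (X.card * l ^ 18))
    (by positivity) (by positivity) Q (fun V => Or.inl rfl) (l + 1) ?_ c (by exact_mod_cast hc) hc1
  · refine (prob_mono (le_trans (by positivity) hc) hc1 ?_).trans
      (hiter.trans (le_of_eq (by push_cast; ring)))
    rintro V hV (hQ | ⟨i, hi, X', hX'X, hX', hX'c, hbig⟩)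
    · omega
    · obtain rfl : l = i := by omega
      have hXl : X.card < 2 ^ l := by
        have := card_le_univ X
        omega
      have h1 : X'.card < 2 := by
        refine lt_of_mul_lt_mul_left (a := 2 ^ l) ?_ (Nat.zero_le _)
        omega
      obtain ⟨x, rfl⟩ := Finset.card_eq_one.1 (by have := hX'.card_pos; omega : X'.card = 1)
      exact hV ⟨x, hX'X (mem_singleton_self x), hbig⟩
  · rintro t - U (rfl | ⟨i, rfl, X', hX'X, hX', hX'c, hbig⟩) b hb hb1
    · have hb0 : 0 ≤ b := le_trans (by positivity) hb
      refine le_trans (prob_mono hb0 hb1 ?_) (hG.prob_reach_small_le hl hn h0 hp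
        (Z := closedNbhd G X) (W := W) hk hkg hgW ?_ hb hb1)
      · intro V hV hcon
        refine hV (Or.inr ⟨0, rfl, X, subset_rfl, hX, by simp, ?_⟩)
        have := card_le_card (sdiff_subset_sdiff (reach_mono (G := G)
          (sdiff_subset_sdiff (subset_union_right (s₁ := U) (s₂ := V)) (subset_refl W))
          (subset_refl (closedNbhd G X)) ((0 + 1) * l ^ 7)) (subset_refl W))
        simp only [zero_add, one_mul] at this ⊢
        omega
      · have h1 : (outerNbhd G X).card ≤ (closedNbhd G X).card := card_le_card subset_union_right
        have h2 := le_card_sdiff W (closedNbhd G X)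
        have h3 : X.card * l ^ 48 + W.card ≤ X.card * l ^ 49 := by
          calc X.card * l ^ 48 + W.card ≤ X.card * l ^ 48 + l ^ 10 * X.card := by gcongr
            _ = X.card * (l ^ 48 + l ^ 10) := by ring
            _ ≤ X.card * (l ^ 48 + l ^ 48) := by gcongr; omega
            _ = X.card * (2 * l ^ 48) := by ring
            _ ≤ X.card * (l * l ^ 48) := by gcongr; omega
            _ = _ := by ring
        omega
    · have hb0 : 0 ≤ b := le_trans (by positivity) hb
      obtain ⟨X₁, hX₁X', hX₁c, hX₁big⟩ : ∃ X₁ ⊆ X', 2 * X₁.card ≤ X'.card + 1 ∧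
          3 * Fintype.card α ≤
            10 * (reach G (U \ W) ((i + 1) * l ^ 7) (closedNbhd G X₁) \ W).card := by
        obtain ⟨X₁, X₂, rfl, h1, h2⟩ := exists_union_halves X'
        rw [closedNbhd_union, reach_union, union_sdiff_distrib] at hbig
        have := card_union_le (reach G (U \ W) ((i + 1) * l ^ 7) (closedNbhd G X₁) \ W)
          (reach G (U \ W) ((i + 1) * l ^ 7) (closedNbhd G X₂) \ W)
        by_cases h : 3 * Fintype.card α ≤
            10 * (reach G (U \ W) ((i + 1) * l ^ 7) (closedNbhd G X₁) \ W).card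
        · exact ⟨X₁, subset_union_left, h1, h⟩
        · exact ⟨X₂, subset_union_right, h2, by omega⟩
      have hX₁ : X₁.Nonempty := by
        rw [nonempty_iff_ne_empty]
        rintro rfl
        have : closedNbhd G (∅ : Finset α) = ∅ := by ext; simp [mem_closedNbhd]
        rw [this, reach_empty] at hX₁big
        have : 0 < X.card * l ^ 49 := by positivity
        simp at hX₁big
        omega
      refine le_trans (prob_mono hb0 hb1 ?_) (hG.prob_reach_small_le hl hn h0 hp
        (Z := reach G (U \ W) ((i + 1) * l ^ 7) (closedNbhd G X₁)) (W := W) hk hkg hgW ?_ hb hb1)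
      · intro V hV hcon
        refine hV (Or.inr ⟨i + 1, rfl, X₁, hX₁X'.trans hX'X, hX₁, ?_, ?_⟩)
        · calc 2 ^ (i + 1) * X₁.card = 2 ^ i * (2 * X₁.card) := by ring
            _ ≤ 2 ^ i * (X'.card + 1) := by gcongr
            _ ≤ _ := by rw [pow_succ]; linarith
        · refine hcon.trans (Nat.mul_le_mul_left _ (card_le_card
            (sdiff_subset_sdiff ?_ (subset_refl W))))
          rw [show (i + 1 + 1) * l ^ 7 = (i + 1) * l ^ 7 + l ^ 7 by ring, reach_add]
          exact reach_mono (sdiff_subset_sdiff subset_union_right subset_rfl)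
            (reach_mono (sdiff_subset_sdiff subset_union_left subset_rfl) subset_rfl _) _
      -- The regrowth starts from 3n/10 vertices, and `n ≥ |X| * l ^ 49` for the original `X`. So
      -- the failure exponent does not shrink with `X'`.
      · refine le_of_mul_le_mul_left (a := 10) ?_ (by norm_num)
        calc 10 * (X.card * l ^ 48) ≤ 3 * l * (X.card * l ^ 48) := by gcongr; omega
          _ = 3 * (X.card * l ^ 49) := by ring
          _ ≤ 3 * Fintype.card α := by gcongr
          _ ≤ _ := hX₁big

end Reach

/-! ### Linking one pair, half of the pairs, all pairs. -/

section Linking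

open Finset
open scoped Classical

variable {α : Type*} [Fintype α] {G : SimpleGraph α} {p : ℝ} {l : ℕ}

/-- Every well-expanding set contains a vertex that reaches more than half of the vertices through
`V`, even after the deletion of a small set. -/
def Spreading (G : SimpleGraph α) (l : ℕ) (V : Finset α) : Prop :=
  ∀ X W : Finset α, X.Nonempty → X.card * l ^ 49 ≤ (outerNbhd G X).card →
    W.card ≤ l ^ 10 * X.card → ∃ x ∈ X, 3 * Fintype.card α ≤
      5 * (reach G (V \ W) ((l + 1) * l ^ 7) (closedNbhd G {x}) \ W).card

/-- For `|X| = k` there are at most `2 ^ (l * k + l ^ 11 * k)` choices of `(X, W)`, far fewer than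
`2 ^ (k * l ^ 18)`. -/
lemma PolyExpander.prob_not_spreading_le (hG : PolyExpander G l) (hl : 8 ≤ l)
    (hn : Fintype.card α + 1 ≤ 2 ^ l) (h0 : 0 < p) (hp : (1 - p) ^ (l ^ 10) ≤ 1 / 2)
    {c : ℝ} (hc : (l + 1) * (l ^ 7 * p) ≤ c) (hc1 : c ≤ 1) :
    prob c (fun V => ¬ Spreading G l V) ≤ (1 / 2) ^ (l ^ 2) := by
  have hc0 : 0 ≤ c := le_trans (by positivity) hc
  let 𝓢 : ℕ → Finset (Finset α × Finset α) := fun k =>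
    (((univ : Finset (Finset α)).filter fun X => X.card ≤ k) ×ˢ
      ((univ : Finset (Finset α)).filter fun W => W.card ≤ l ^ 10 * k)).filter fun e =>
        e.1.card = k ∧ e.1.card * l ^ 49 ≤ (outerNbhd G e.1).card
  let bad : Finset α × Finset α → Finset α → Prop := fun e V => ¬ ∃ x ∈ e.1,
    3 * Fintype.card α ≤
      5 * (reach G (V \ e.2) ((l + 1) * l ^ 7) (closedNbhd G {x}) \ e.2).card
  have hbad : ∀ k ∈ Icc 1 (Fintype.card α), prob c (fun V => ∃ e ∈ 𝓢 k, bad e V) ≤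
      (1 / 2) ^ (l ^ 2 + l) := by
    intro k hk
    rw [mem_Icc] at hk
    have hcard : (𝓢 k).card ≤ 2 ^ (l * k + l * (l ^ 10 * k)) := by
      refine (card_filter_le _ _).trans ?_
      rw [card_product, pow_add, pow_mul, pow_mul]
      exact Nat.mul_le_mul ((card_small_subsets_le k).trans (Nat.pow_le_pow_left hn _))
        ((card_small_subsets_le _).trans (Nat.pow_le_pow_left hn _))
    have hterm : ∀ e ∈ 𝓢 k, prob c (bad e) ≤
        ((l : ℝ) + 1) * ((l : ℝ) ^ 7 * (1 / 2) ^ (k * l ^ 18)) := by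
      intro e he
      simp only [𝓢, mem_filter, mem_product, mem_univ, true_and] at he
      obtain ⟨⟨-, h2⟩, rfl, h3⟩ := he
      exact hG.prob_no_vertex_reaches_le hl hn h0 hp (card_pos.1 hk.1) h3 h2 hc hc1
    refine ((prob_exists_le hc0 hc1 (𝓢 k) bad).trans (sum_le_card_nsmul _ _ _ hterm)).trans ?_
    rw [nsmul_eq_mul, ← mul_assoc (l + 1 : ℝ), ← mul_assoc]
    refine mul_half_pow_le (x := l * k + l * (l ^ 10 * k) + 8 * l) ?_ ?_
    · have h2 : (l + 1) * l ^ 7 ≤ 2 ^ (8 * l) := by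
        calc (l + 1) * l ^ 7 ≤ 2 ^ l * (2 ^ l) ^ 7 :=
              Nat.mul_le_mul Nat.lt_two_pow_self
                (Nat.pow_le_pow_left Nat.lt_two_pow_self.le _)
          _ = _ := by ring
      have := Nat.mul_le_mul hcard h2
      rw [← pow_add] at this
      exact_mod_cast this
    · have h3 : l ≤ l ^ 11 := Nat.le_self_pow (by norm_num) l
      have h4 : l ^ 2 ≤ l ^ 11 := Nat.pow_le_pow_right (by omega) (by norm_num)
      have h5 : 9 * l ≤ 2 * l ^ 2 := by nlinarith
      have h6 : 8 * l ^ 11 ≤ l ^ 18 := by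
        calc 8 * l ^ 11 ≤ l * l ^ 11 := by gcongr
          _ = l ^ 12 := by ring
          _ ≤ _ := Nat.pow_le_pow_right (by omega) (by norm_num)
      calc l * k + l * (l ^ 10 * k) + 8 * l + (l ^ 2 + l)
          ≤ l * k + l * (l ^ 10 * k) + (3 * l ^ 2) * k := by nlinarith
        _ = k * (l + l ^ 11 + 3 * l ^ 2) := by ring
        _ ≤ k * l ^ 18 := by gcongr; omega
  refine (prob_mono hc0 hc1
    (B := fun V => ∃ k ∈ Icc 1 (Fintype.card α), ∃ e ∈ 𝓢 k, bad e V) ?_).trans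
    ((prob_exists_le hc0 hc1 _ _).trans ((sum_le_card_nsmul _ _ _ hbad).trans ?_))
  · intro V hV
    simp only [Spreading] at hV
    push Not at hV
    obtain ⟨X, W, hX, hXN, hW, hXW⟩ := hV
    refine ⟨X.card, mem_Icc.2 ⟨hX.card_pos, card_le_univ X⟩, (X, W), ?_, ?_⟩
    · simp [𝓢, hW, hXN]
    · simpa [bad] using hXW
  · rw [nsmul_eq_mul]
    refine mul_half_pow_le (x := l) ?_ (by omega)
    have : (Icc 1 (Fintype.card α)).card ≤ 2 ^ l := by
      rw [Nat.card_Icc]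
      omega
    exact_mod_cast this

/-- Two sets of 3n/5 vertices share n/5. The sets `B W x` are fixed before `V` is drawn, so they may
come from an earlier exposure, and there are few choices of `W`. -/
lemma prob_misses_intersection_le (hl : 8 ≤ l) (hn : Fintype.card α + 1 ≤ 2 ^ l)
    (hln : l ^ 30 ≤ Fintype.card α) (h0 : 0 ≤ p) (h1 : p ≤ 1)
    (hp : (1 - p) ^ (l ^ 10) ≤ 1 / 2) (B : Finset α → α → Finset α) :
    prob p (fun V => ∃ x y, ∃ W : Finset α, W.card * l ^ 39 ≤ Fintype.card α ∧
      3 * Fintype.card α ≤ 5 * (B W x \ W).card ∧ 3 * Fintype.card α ≤ 5 * (B W y \ W).card ∧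
      Disjoint ((B W x ∩ B W y) \ W) V) ≤ (1 / 2) ^ (l ^ 2) := by
  set n := Fintype.card α with hndef
  have hl0 : 0 < l := by omega
  set w := n / l ^ 39 with hw
  obtain ⟨m, hm, hm'⟩ : ∃ m, m * l ^ 12 ≤ n ∧ n < (m + 1) * l ^ 12 := by
    refine ⟨n / l ^ 12, Nat.div_mul_le_self _ _, ?_⟩
    rw [mul_comm]
    exact Nat.lt_mul_div_succ _ (by positivity)
  have hwn : w * l ^ 39 ≤ n := Nat.div_mul_le_self _ _
  let 𝓕 : Finset (Finset α) := (((univ : Finset (α × α)) ×ˢ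
    ((univ : Finset (Finset α)).filter fun W => W.card ≤ w)).filter fun e =>
      n ≤ 5 * ((B e.2 e.1.1 ∩ B e.2 e.1.2) \ e.2).card).image fun e =>
        (B e.2 e.1.1 ∩ B e.2 e.1.2) \ e.2
  have h𝓕 : ∀ S ∈ 𝓕, l ^ 10 * m ≤ S.card := by
    intro S hS
    obtain ⟨e, he, rfl⟩ := mem_image.1 hS
    refine le_of_mul_le_mul_left (a := 5) ?_ (by norm_num)
    calc 5 * (l ^ 10 * m) ≤ (l * l) * (l ^ 10 * m) := by gcongr; nlinarith
      _ = m * l ^ 12 := by ring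
      _ ≤ n := hm
      _ ≤ _ := (mem_filter.1 he).2
  refine (prob_mono h0 h1 (B := fun V => ∃ S ∈ 𝓕, Disjoint S V) ?_).trans
    ((prob_exists_disjoint_le h0 h1 hp 𝓕 h𝓕).trans
      (mul_half_pow_le (x := l * 2 + l * w) ?_ ?_))
  · rintro V ⟨x, y, W, hW, hx, hy, hV⟩
    refine ⟨_, mem_image.2 ⟨((x, y), W), ?_, rfl⟩, hV⟩
    simp only [mem_filter, mem_product, mem_univ, true_and]
    refine ⟨(Nat.le_div_iff_mul_le (by positivity)).2 hW, ?_⟩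
    have h2 := card_union_add_card_inter (B W x \ W) (B W y \ W)
    have h3 := card_le_univ ((B W x \ W) ∪ (B W y \ W))
    have h4 : (B W x ∩ B W y) \ W = (B W x \ W) ∩ (B W y \ W) := by
      ext v
      simp only [mem_sdiff, mem_inter]
      tauto
    rw [h4]
    omega
  · have : 𝓕.card ≤ 2 ^ (l * 2 + l * w) := by
      refine card_image_le.trans ((card_filter_le _ _).trans ?_)
      rw [card_product, card_univ, Fintype.card_prod, pow_add, pow_mul, pow_mul]
      refine Nat.mul_le_mul ?_ ((card_small_subsets_le w).trans (Nat.pow_le_pow_left hn _))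
      rw [sq]
      exact Nat.mul_le_mul (by omega) (by omega)
    exact_mod_cast this
  · have h2 : l ^ 18 ≤ m := by
      refine Nat.le_of_lt_succ (lt_of_mul_lt_mul_right (a := l ^ 12) ?_ (by positivity))
      calc l ^ 18 * l ^ 12 = l ^ 30 := by ring
        _ ≤ n := hln
        _ < _ := hm'
    have h18 : 0 < l ^ 18 := by positivity
    have h3 : w * l ^ 27 ≤ 2 * m := by
      refine le_of_mul_le_mul_right (a := l ^ 12) ?_ (by positivity)
      calc w * l ^ 27 * l ^ 12 = w * l ^ 39 := by ring
        _ ≤ (m + 1) * l ^ 12 := by omega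
        _ ≤ (2 * m) * l ^ 12 := by gcongr; omega
    have h4 : 4 * (l * w) ≤ 2 * m := by
      refine le_trans ?_ h3
      calc 4 * (l * w) = w * (4 * l) := by ring
        _ ≤ w * (l * l ^ 26) := by
          gcongr
          · omega
          · exact Nat.le_self_pow (by norm_num) l
        _ = _ := by ring
    have h5 : 4 * l + 2 * l ^ 2 ≤ l ^ 18 := by
      calc 4 * l + 2 * l ^ 2 ≤ l * l ^ 2 := by nlinarith
        _ = l ^ 3 := by ring
        _ ≤ _ := Nat.pow_le_pow_right hl0 (by norm_num)
    omega

/-- The pairs `x i, y i` consist of distinct vertices, all sets of which expand well. -/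
def WellExpandingPairs (G : SimpleGraph α) (l : ℕ) {r : ℕ} (x y : Fin r → α) : Prop :=
  Function.Injective (Sum.elim x y) ∧ ∀ X : Finset α, (X : Set α) ⊆ Set.range x ∪ Set.range y →
    X.card * l ^ 49 ≤ (outerNbhd G X).card

/-- Among any set of well-expanding pairs, some pair is joined by a short path through `V` that
avoids a given small set. -/
def Linked (G : SimpleGraph α) (l : ℕ) (V : Finset α) : Prop :=
  ∀ (r : ℕ) (x y : Fin r → α), WellExpandingPairs G l x y → ∀ I : Finset (Fin r), I.Nonempty →
    ∀ W : Finset α, W.card ≤ l ^ 9 * I.card → ∃ i ∈ I, ∃ P : G.Path (x i) (y i),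
      ∃ F : Finset α, pathInterior P = F ∧ F ⊆ V \ W ∧ F.card ≤ l ^ 9

/-- If at least half of the `x i` failed, the failing ones would form a set large enough relative to
`W` for `Spreading` to find a non-failing vertex among them. -/
lemma Spreading.two_mul_card_lt {V : Finset α} (hV : Spreading G l V) (hl : 8 ≤ l) {r : ℕ}
    {x : Fin r → α} (hx : Function.Injective x)
    (hxN : ∀ X : Finset α, (X : Set α) ⊆ Set.range x → X.card * l ^ 49 ≤ (outerNbhd G X).card)
    {I : Finset (Fin r)} (hI : I.Nonempty) {W : Finset α} (hW : W.card ≤ l ^ 9 * I.card) :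
    2 * (I.filter fun i => ¬ 3 * Fintype.card α ≤
      5 * (reach G (V \ W) ((l + 1) * l ^ 7) (closedNbhd G {x i}) \ W).card).card < I.card := by
  by_contra hcon
  rw [not_lt] at hcon
  set J := I.filter fun i => ¬ 3 * Fintype.card α ≤
      5 * (reach G (V \ W) ((l + 1) * l ^ 7) (closedNbhd G {x i}) \ W).card with hJ
  have hJc : (J.image x).card = J.card := card_image_of_injective _ hx
  have hIpos := hI.card_pos
  obtain ⟨v, hv, hvr⟩ := hV (J.image x) W (by rw [← card_pos, hJc]; omega)
    (hxN _ (by rw [coe_image]; exact Set.image_subset_range _ _)) (by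
      rw [hJc]
      calc W.card ≤ l ^ 9 * I.card := hW
        _ ≤ l ^ 9 * (l * J.card) := by gcongr; nlinarith
        _ = _ := by ring)
  obtain ⟨i, hi, rfl⟩ := mem_image.1 hv
  exact (mem_filter.1 hi).2 hvr

lemma PolyExpander.prob_not_linked_le (hG : PolyExpander G l) (hl : 8 ≤ l)
    (hn : Fintype.card α + 1 ≤ 2 ^ l) (hln : l ^ 30 ≤ Fintype.card α) (h0 : 0 < p)
    (hp : (1 - p) ^ (l ^ 10) ≤ 1 / 2) {c : ℝ} (hc : 2 * ((l + 1) * (l ^ 7 * p)) ≤ c)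
    (hc1 : c ≤ 1) :
    prob c (fun V => ¬ Linked G l V) ≤ 2 * (1 / 2) ^ (l ^ 2) := by
  have hl0 : 0 < l := by omega
  -- Two exposures: the first gives `Spreading`, the second the meeting points.
  let Q : ℕ → Finset α → Prop := fun t V =>
    (t = 1 → Spreading G l V) ∧ (t = 2 → Linked G l V)
  have hpos : (0 : ℝ) < (l + 1) * (l ^ 7 * p) := by
    have : (0 : ℝ) < l := by exact_mod_cast hl0
    positivity
  have hiter := prob_not_iterate_le (p := (l + 1) * (l ^ 7 * p)) (q := (1 / 2) ^ (l ^ 2))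
    hpos (by positivity) Q (fun V => ⟨by simp, by simp⟩) 2 ?_ c (by exact_mod_cast hc) hc1
  · refine le_trans (prob_mono (hpos.le.trans (by linarith)) hc1 ?_) hiter
    exact fun V hV hQ => hV (hQ.2 rfl)
  intro t ht U hU b hb hb1
  have hb0 : 0 ≤ b := hpos.le.trans hb
  obtain rfl | rfl : t = 0 ∨ t = 1 := by omega
  · refine (prob_mono hb0 hb1 ?_).trans (hG.prob_not_spreading_le hl hn h0 hp hb hb1)
    intro V hV hS
    refine hV ⟨fun _ X W hX hXN hW => ?_, by simp⟩
    obtain ⟨x, hx, hxr⟩ := hS X W hX hXN hW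
    refine ⟨x, hx, hxr.trans (Nat.mul_le_mul_left _ (card_le_card
      (sdiff_subset_sdiff (reach_mono ?_ subset_rfl _) subset_rfl)))⟩
    exact sdiff_subset_sdiff subset_union_right subset_rfl
  · have hU1 := hU.1 rfl
    have hpb : p ≤ b := by
      refine le_trans ?_ hb
      have h1 : (1 : ℝ) ≤ (l + 1) * l ^ 7 := by
        have : 1 ≤ (l + 1) * l ^ 7 := Nat.mul_pos (by omega) (by positivity)
        exact_mod_cast this
      nlinarith
    have hpb' : (1 - b) ^ (l ^ 10) ≤ 1 / 2 :=
      (pow_le_pow_left₀ (by linarith) (by linarith) _).trans hp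
    refine (prob_mono hb0 hb1 ?_).trans (prob_misses_intersection_le hl hn hln hb0 hb1 hpb'
      fun W x => reach G (U \ W) ((l + 1) * l ^ 7) (closedNbhd G {x}))
    intro V hV
    by_contra hcon
    refine hV ⟨by simp, fun _ r x y hxy I hI W hW => ?_⟩
    have hxinj : Function.Injective x := fun i j h =>
      Sum.inl_injective (hxy.1 (by simpa using h : Sum.elim x y (.inl i) = Sum.elim x y (.inl j)))
    have hyinj : Function.Injective y := fun i j h =>
      Sum.inr_injective (hxy.1 (by simpa using h : Sum.elim x y (.inr i) = Sum.elim x y (.inr j)))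
    have h1 := hU1.two_mul_card_lt hl hxinj
      (fun X hX => hxy.2 X (hX.trans Set.subset_union_left)) hI hW
    have h2 := hU1.two_mul_card_lt hl hyinj
      (fun X hX => hxy.2 X (hX.trans Set.subset_union_right)) hI hW
    obtain ⟨i, hiI, hix, hiy⟩ : ∃ i ∈ I,
        3 * Fintype.card α ≤
          5 * (reach G (U \ W) ((l + 1) * l ^ 7) (closedNbhd G {x i}) \ W).card ∧
        3 * Fintype.card α ≤
          5 * (reach G (U \ W) ((l + 1) * l ^ 7) (closedNbhd G {y i}) \ W).card := by
      by_contra! hno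
      have hsub : I ⊆ (I.filter fun i => ¬ 3 * Fintype.card α ≤
          5 * (reach G (U \ W) ((l + 1) * l ^ 7) (closedNbhd G {x i}) \ W).card) ∪
          (I.filter fun i => ¬ 3 * Fintype.card α ≤
          5 * (reach G (U \ W) ((l + 1) * l ^ 7) (closedNbhd G {y i}) \ W).card) := by
        intro i hi
        rw [mem_union, mem_filter, mem_filter]
        by_cases h : 3 * Fintype.card α ≤
          5 * (reach G (U \ W) ((l + 1) * l ^ 7) (closedNbhd G {x i}) \ W).card
        · exact Or.inr ⟨hi, not_le.2 (hno i hi h)⟩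
        · exact Or.inl ⟨hi, h⟩
      have := (card_le_card hsub).trans (card_union_le _ _)
      omega
    -- Well-expansion of the `x i` with `i ∈ I` forces `|I| * l ^ 49 ≤ n`.
    have hWn : W.card * l ^ 39 ≤ Fintype.card α := by
      have h3 := hxy.2 (I.image x) (by
        rw [coe_image]
        exact (Set.image_subset_range _ _).trans Set.subset_union_left)
      rw [card_image_of_injective _ hxinj] at h3
      calc W.card * l ^ 39 ≤ l ^ 9 * I.card * l ^ 39 := by gcongr
        _ = I.card * l ^ 48 := by ring
        _ ≤ I.card * l ^ 49 := by gcongr; omega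
        _ ≤ _ := h3.trans (card_le_univ _)
    have hmeet : ¬ Disjoint ((reach G (U \ W) ((l + 1) * l ^ 7) (closedNbhd G {x i}) ∩
        reach G (U \ W) ((l + 1) * l ^ 7) (closedNbhd G {y i})) \ W) V :=
      fun hd => hcon ⟨x i, y i, W, hWn, hix, hiy, hd⟩
    obtain ⟨z, hz, hzV⟩ := Finset.not_disjoint_iff.1 hmeet
    rw [mem_sdiff, mem_inter] at hz
    obtain ⟨P, F, hPF, hF, hFc⟩ := exists_path_of_mem_reach (S' := (U ∪ V) \ W)
      (sdiff_subset_sdiff subset_union_left subset_rfl) hz.1.1 hz.1.2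
      (by simp [hzV, hz.2])
    refine ⟨i, hiI, P, F, hPF, hF, hFc.trans ?_⟩
    have h7 : 1 ≤ l ^ 7 := Nat.one_le_pow _ _ hl0
    calc 2 * ((l + 1) * l ^ 7) + 3 ≤ (2 * l + 5) * l ^ 7 := by nlinarith
      _ ≤ (l * l) * l ^ 7 := by gcongr; nlinarith
      _ = _ := by ring

/-- For any set of well-expanding pairs, all but a proportion of `2⁻ᵐ` of them can be joined by
paths with disjoint interiors in `V`. -/
def Joins (G : SimpleGraph α) (l m : ℕ) (V : Finset α) : Prop :=
  ∀ (r : ℕ) (x y : Fin r → α), WellExpandingPairs G l x y → ∀ I : Finset (Fin r),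
    ∃ J ⊆ I, 2 ^ m * (I \ J).card ≤ I.card ∧ ∃ f : Fin r → Finset α,
      (∀ i ∈ J, (∃ P : G.Path (x i) (y i), pathInterior P = f i) ∧ f i ⊆ V) ∧
      (J : Set (Fin r)).PairwiseDisjoint f

/-- Take a maximal family of disjoint short paths. If more than half of the pairs were left, the
used vertices would be few enough to serve as `W`, and another pair could be joined. -/
lemma Linked.joins {V : Finset α} (hV : Linked G l V) : Joins G l 1 V := by
  intro r x y hxy I
  obtain ⟨J, hJ, hmax⟩ := Finset.exists_max_image (I.powerset.filter fun J : Finset (Fin r) =>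
    ∃ f : Fin r → Finset α, (∀ i ∈ J, (∃ P : G.Path (x i) (y i), pathInterior P = f i) ∧
      f i ⊆ V ∧ (f i).card ≤ l ^ 9) ∧ (J : Set (Fin r)).PairwiseDisjoint f) Finset.card
    ⟨∅, by simp⟩
  rw [mem_filter, mem_powerset] at hJ
  obtain ⟨hJI, f, hf, hfd⟩ := hJ
  refine ⟨J, hJI, ?_, f, fun i hi => ⟨(hf i hi).1, (hf i hi).2.1⟩, hfd⟩
  by_contra! hcon
  rw [pow_one] at hcon
  have hIJ := card_sdiff_add_card_eq_card hJI
  obtain ⟨i, hi, P, F, hPF, hFV, hFc⟩ := hV r x y hxy (I \ J) (by rw [← card_pos]; omega)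
    (J.biUnion f) (by
      refine (card_biUnion_le_card_mul _ _ _ fun i hi => (hf i hi).2.2).trans ?_
      rw [mul_comm]
      exact Nat.mul_le_mul_left _ (by omega))
  rw [mem_sdiff] at hi
  have := hmax (insert i J) (by
    rw [mem_filter, mem_powerset]
    have hne : ∀ j ∈ J, j ≠ i := by
      rintro j hj rfl
      exact hi.2 hj
    refine ⟨insert_subset hi.1 hJI, Function.update f i F, ?_, ?_⟩
    · intro j hj
      rw [mem_insert] at hj
      by_cases hji : j = i
      · subst hji
        rw [Function.update_self]
        exact ⟨⟨P, hPF⟩, hFV.trans sdiff_subset, hFc⟩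
      · rw [Function.update_of_ne hji]
        exact hf j (hj.resolve_left hji)
    · rw [coe_insert]
      refine Set.PairwiseDisjoint.insert ?_ ?_
      · intro a ha b hb hab
        rw [Function.onFun, Function.update_of_ne (hne a ha), Function.update_of_ne (hne b hb)]
        exact hfd ha hb hab
      · intro j hj _
        rw [Function.update_self, Function.update_of_ne (hne j hj), Finset.disjoint_left]
        intro v hv hvj
        exact (mem_sdiff.1 (hFV hv)).2 (mem_biUnion.2 ⟨j, hj, hvj⟩))
  rw [card_insert_of_notMem hi.2] at this
  omega

/-- The second set serves the pairs left over by the first; its disjointness from the first keeps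
the interiors apart. -/
lemma Joins.add {U V W : Finset α} {m m' : ℕ} (hU : Joins G l m U) (hV : Joins G l m' V)
    (hUW : U ⊆ W) (hVW : V ⊆ W) (hUV : Disjoint U V) : Joins G l (m + m') W := by
  intro r x y hxy I
  obtain ⟨J, hJI, hJ, f, hf, hfd⟩ := hU r x y hxy I
  obtain ⟨J', hJ'I, hJ', f', hf', hfd'⟩ := hV r x y hxy (I \ J)
  have hJ'J : ∀ i ∈ J', i ∉ J := fun i hi => (mem_sdiff.1 (hJ'I hi)).2
  refine ⟨J ∪ J', union_subset hJI (hJ'I.trans sdiff_subset), ?_,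
    fun i => if i ∈ J then f i else f' i, ?_, ?_⟩
  · calc 2 ^ (m + m') * (I \ (J ∪ J')).card = 2 ^ (m + m') * ((I \ J) \ J').card := by
          rw [sdiff_sdiff_left]
          rfl
      _ = 2 ^ m * (2 ^ m' * ((I \ J) \ J').card) := by ring
      _ ≤ 2 ^ m * (I \ J).card := by gcongr
      _ ≤ _ := hJ
  · intro i hi
    by_cases hiJ : i ∈ J
    · simp only [hiJ, if_true]
      exact ⟨(hf i hiJ).1, (hf i hiJ).2.trans hUW⟩
    · simp only [hiJ, if_false]
      have := hf' i ((mem_union.1 hi).resolve_left hiJ)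
      exact ⟨this.1, this.2.trans hVW⟩
  · intro i hi j hj hij
    rw [mem_coe, mem_union] at hi hj
    simp only [Function.onFun]
    rcases hi with hi | hi <;> rcases hj with hj | hj
    · simpa [hi, hj] using hfd hi hj hij
    · simpa [hi, hJ'J j hj] using hUV.mono (hf i hi).2 (hf' j hj).2
    · simpa [hj, hJ'J i hi] using hUV.symm.mono (hf' i hi).2 (hf j hj).2
    · simpa [hJ'J i hi, hJ'J j hj] using hfd' hi hj hij

/-- Split into two halves `h` times: each split doubles the exponent in `Joins` and the failure
bound. -/
lemma prob_not_joins_le (h0 : 0 ≤ p) (h1 : p ≤ 1) (h : ℕ) :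
    prob p (fun V => ¬ Joins G l (2 ^ h) V) ≤
      2 ^ h * prob (p / 2 ^ h) (fun V => ¬ Linked G l V) := by
  induction h generalizing p with
  | zero =>
    simp only [pow_zero, one_mul, div_one]
    exact prob_mono h0 h1 fun V hV hL => hV hL.joins
  | succ h ih =>
    refine (prob_not_split_le h0 h1 (Joins G l (2 ^ h)) _ fun U V W hUW hVW hUV hU hV => ?_).trans
      ((mul_le_mul_of_nonneg_left (ih (p := p / 2) (by linarith) (by linarith))
        zero_le_two).trans (le_of_eq ?_))
    · have := hU.add hV hUW hVW hUV
      rwa [← two_mul, ← pow_succ'] at this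
    · rw [div_div, ← pow_succ', ← mul_assoc, ← pow_succ']

/-- There are at most `n < 2 ^ m` pairs, so a proportion of `2 ^ (-m)` unjoined means none. -/
lemma Joins.connectsThrough {V : Finset α} {m : ℕ} (hV : Joins G l m V)
    (hm : Fintype.card α < 2 ^ m)
    (hl : (l : ℝ) ^ 49 ≤ Real.logb 2 (Fintype.card α : ℝ) ^ 50) :
    ConnectsThrough G (V : Set α) := by
  intro r x y hxy hX
  obtain ⟨J, -, hJ, f, hf, hfd⟩ := hV r x y ⟨hxy, fun X hXxy => by
    have h1 := (mul_le_mul_of_nonneg_left hl (Nat.cast_nonneg X.card)).trans (hX X hXxy)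
    exact_mod_cast h1⟩ univ
  have hr : r ≤ Fintype.card α := by
    have := Fintype.card_le_of_injective x fun i j h =>
      Sum.inl_injective (hxy (by simpa using h : Sum.elim x y (.inl i) = Sum.elim x y (.inl j)))
    simpa using this
  have hJu : ∀ i, i ∈ J := by
    intro i
    by_contra hi
    have h1 : 0 < (univ \ J).card := card_pos.2 ⟨i, by simp [hi]⟩
    rw [card_univ, Fintype.card_fin] at hJ
    have := Nat.le_mul_of_pos_right (2 ^ m) h1
    omega
  choose P hP using fun i => (hf i (hJu i)).1
  refine ⟨P, fun i => ?_, fun i j hij => ?_⟩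
  · rw [hP]
    exact_mod_cast (hf i (hJu i)).2
  · rw [hP, hP, Finset.disjoint_coe]
    exact hfd (hJu i) (hJu j) hij

end Linking

/-! ### Choice of parameters. -/

section Parameters

open Finset

variable {α : Type*} [Fintype α] {G : SimpleGraph α}

lemma pow_le_logb_pow {L : ℝ} {l : ℕ} (hL : 2 ^ 49 ≤ L) (hl : (l : ℝ) ≤ 2 * L) :
    (l : ℝ) ^ 49 ≤ L ^ 50 := by
  have hL0 : 0 ≤ L := le_trans (by positivity) hL
  calc (l : ℝ) ^ 49 ≤ (2 * L) ^ 49 := pow_le_pow_left₀ (by positivity) hl _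
    _ = 2 ^ 49 * L ^ 49 := mul_pow _ _ _
    _ ≤ L * L ^ 49 := by gcongr
    _ = _ := by ring

/-- One spare logarithm absorbs each constant: `2 ^ 9 * L ^ 2 ≤ l ^ 3` for the expansion rate, and
`(2 * L) ^ 49 ≤ L ^ 50` for the deleted edges. -/
lemma IsWeakExpander.polyExpander {ε s : ℝ} {l : ℕ} (hG : IsWeakExpander G ε s)
    (hε : (2 : ℝ)⁻¹ ^ 9 ≤ ε) (hs : 2 ^ 11 * Real.logb 2 (Fintype.card α : ℝ) ^ 50 ≤ s)
    (hL : 2 ^ 49 ≤ Real.logb 2 (Fintype.card α : ℝ))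
    (hLl : Real.logb 2 (Fintype.card α : ℝ) ≤ l)
    (hl : (l : ℝ) ≤ 2 * Real.logb 2 (Fintype.card α : ℝ)) : PolyExpander G l := by
  intro U F hU hUc hF hFc
  set L := Real.logb 2 (Fintype.card α : ℝ)
  have hL0 : 0 < L := lt_of_lt_of_le (by positivity) hL
  have h1 := hG U F hU.card_pos (by
    have : (3 : ℝ) * U.card ≤ 2 * Fintype.card α := by exact_mod_cast hUc
    linarith) hF (by
    have h2 : (F.card : ℝ) ≤ (l : ℝ) ^ 49 * U.card := by exact_mod_cast hFc
    refine h2.trans (mul_le_mul_of_nonneg_right ?_ (by positivity))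
    have h3 := pow_le_logb_pow hL hl
    have h4 : 0 ≤ L ^ 50 := by positivity
    linarith)
  rw [div_le_iff₀ (by positivity)] at h1
  set N := (outerNbhd (G.deleteEdges (F : Set (Sym2 α))) U).card
  have h5 : (U.card : ℝ) ≤ (l : ℝ) ^ 3 * N := by
    have h6 : (2 : ℝ)⁻¹ ^ 9 * U.card ≤ N * L ^ 2 :=
      (mul_le_mul_of_nonneg_right hε (by positivity)).trans h1
    have h7 : (2 : ℝ) ^ 9 ≤ l := le_trans (by norm_num) (hL.trans hLl)
    calc (U.card : ℝ) = 2 ^ 9 * ((2 : ℝ)⁻¹ ^ 9 * U.card) := by ring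
      _ ≤ 2 ^ 9 * (N * L ^ 2) := by gcongr
      _ ≤ l * (N * (l : ℝ) ^ 2) := by gcongr
      _ = _ := by ring
  exact_mod_cast h5

lemma one_sub_pow_le_half {p : ℝ} {m : ℕ} (h1 : p ≤ 1) (h : 1 ≤ p * m) :
    (1 - p) ^ m ≤ 1 / 2 := by
  calc (1 - p) ^ m ≤ Real.exp (-p) ^ m :=
        pow_le_pow_left₀ (by linarith) (Real.one_sub_le_exp_neg p) _
    _ = Real.exp (-(p * m)) := by rw [← Real.exp_nat_mul]; ring_nf
    _ ≤ Real.exp (-1) := Real.exp_le_exp.2 (by linarith)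
    _ ≤ 1 / 2 := by
        rw [Real.exp_neg, one_div]
        refine inv_anti₀ (by norm_num) ?_
        have := Real.add_one_le_exp (1 : ℝ)
        linarith

/-- With high probability, a random set with density `1 / 6` joins almost all well-expanding
pairs. -/
lemma PolyExpander.prob_not_joins_le {l h : ℕ} (hG : PolyExpander G l) (hl : 48 ≤ l)
    (hn : Fintype.card α + 1 ≤ 2 ^ l) (hln : l ^ 30 ≤ Fintype.card α) (hh : 2 ^ h ≤ 2 * l) :
    prob (1 / 6) (fun V => ¬ Joins G l (2 ^ h) V) ≤ (1 / 2) ^ l := by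
  have hlR : (48 : ℝ) ≤ l := by exact_mod_cast hl
  have hhR : (2 : ℝ) ^ h ≤ 2 * l := by exact_mod_cast hh
  have hl0 : (0 : ℝ) < l := by linarith
  -- Each of the `2 ^ h ≤ 2 * l` parts has density at least `1 / (12 * l)`. Dividing by `2 * (l + 1)
  -- * l ^ 7` leaves `p ≥ 1 / (48 * l ^ 9)`, hence `p * l ^ 10 ≥ 1` when `l ≥ 48`.
  set c : ℝ := 1 / 6 / 2 ^ h with hc
  have hc0 : 0 < c := by positivity
  have hc1 : c ≤ 1 := by
    rw [hc, div_le_iff₀ (by positivity)]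
    have : (1 : ℝ) ≤ 2 ^ h := one_le_pow₀ (by norm_num)
    linarith
  set p : ℝ := c / (2 * ((l + 1) * l ^ 7)) with hp
  have hp0 : 0 < p := by positivity
  have hcp : 2 * ((l + 1) * (l ^ 7 * p)) = c := by
    rw [hp]
    field_simp
  have hp1 : p ≤ 1 := by
    refine (div_le_self hc0.le ?_).trans hc1
    have : (1 : ℝ) ≤ (l : ℝ) ^ 7 := one_le_pow₀ (by linarith)
    nlinarith
  have hpl : 1 ≤ p * ((l ^ 10 : ℕ) : ℝ) := by
    rw [hp, hc, div_div, div_div, div_mul_eq_mul_div, one_mul,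
      le_div_iff₀ (by positivity), one_mul]
    push_cast
    calc 6 * ((2 : ℝ) ^ h * (2 * ((l + 1) * l ^ 7)))
        ≤ 6 * ((2 * l) * (2 * ((l + l) * l ^ 7))) := by gcongr; linarith
      _ = 48 * (l : ℝ) ^ 9 := by ring
      _ ≤ l * (l : ℝ) ^ 9 := by gcongr
      _ = _ := by ring
  refine (_root_.prob_not_joins_le (by norm_num) (by norm_num) h).trans ?_
  have hlink := hG.prob_not_linked_le (by omega) hn hln hp0 (one_sub_pow_le_half hp1 hpl)
    hcp.le hc1
  refine (mul_le_mul_of_nonneg_left hlink (by positivity)).trans ?_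
  rw [← mul_assoc]
  refine mul_half_pow_le (x := l + 2) ?_ ?_
  · have h2 : (l : ℝ) ≤ 2 ^ l := by exact_mod_cast (Nat.lt_two_pow_self (n := l)).le
    calc (2 : ℝ) ^ h * 2 ≤ 2 * l * 2 := by gcongr
      _ = l * 2 ^ 2 := by ring
      _ ≤ 2 ^ l * 2 ^ 2 := by gcongr
      _ = _ := by rw [pow_add]
  · nlinarith

end Parameters

theorem lemma5p6 (δ : ℝ) (hδ : 0 < δ) :
    ∃ n₀ : ℕ, ∀ (α : Type*) [Fintype α] (G : SimpleGraph α) (ε s : ℝ),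
      n₀ ≤ Fintype.card α →
      (2 : ℝ)⁻¹ ^ 9 ≤ ε → ε < 1 →
      2 ^ 11 * Real.logb 2 (Fintype.card α : ℝ) ^ 50 ≤ s →
      IsWeakExpander G ε s →
      1 - δ ≤ (sixthRandomSubset α).real {V : Set α | ConnectsThrough G V} := by
  obtain ⟨N, hN⟩ : ∃ N : ℕ, ∀ l ≥ N, (1 / 2 : ℝ) ^ l ≤ δ ∧ (l : ℝ) ^ 30 / 2 ^ l ≤ 1 / 2 ∧
      (2 : ℝ) ^ 49 + 1 ≤ l := by
    have h1 := (tendsto_pow_atTop_nhds_zero_of_lt_one (by norm_num : (0 : ℝ) ≤ 1 / 2)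
      (by norm_num)).eventually_le_const hδ
    have h2 := (tendsto_pow_const_div_const_pow_of_one_lt 30
      (by norm_num : (1 : ℝ) < 2)).eventually_le_const (by norm_num : (0 : ℝ) < 1 / 2)
    have h3 := (tendsto_natCast_atTop_atTop (R := ℝ)).eventually_ge_atTop ((2 : ℝ) ^ 49 + 1)
    exact Filter.eventually_atTop.1 (h1.and (h2.and h3))
  refine ⟨2 ^ N, fun α _ G ε s hn hε _ hs hG => ?_⟩
  set n := Fintype.card α with hndef
  -- This gives `l - 1 ≤ log₂ n ≤ l` and `n < 2 ^ l`.
  set l := Nat.clog 2 (n + 1) with hl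
  have hnl : n + 1 ≤ 2 ^ l := Nat.le_pow_clog (by norm_num) _
  have hlN : N ≤ l := by
    by_contra! hcon
    have := Nat.pow_lt_pow_right (a := 2) (by norm_num) hcon
    omega
  obtain ⟨hlδ, hl30, hl49⟩ := hN l hlN
  have hl48 : 48 ≤ l := by
    have : (48 : ℝ) ≤ l := le_trans (by norm_num) hl49
    exact_mod_cast this
  have hln : 2 ^ (l - 1) ≤ n := by
    have := Nat.pow_pred_clog_lt_self (b := 2) (by norm_num) (x := n + 1)
      (by have : 0 < 2 ^ N := by positivity
          omega)
    rw [← hl, Nat.pred_eq_sub_one] at this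
    omega
  have hn0 : 0 < n := lt_of_lt_of_le (by positivity) hln
  have hlpred : ((l - 1 : ℕ) : ℝ) = l - 1 := by
    rw [Nat.cast_sub (by omega)]
    simp
  have hlL : (l : ℝ) - 1 ≤ Real.logb 2 (n : ℝ) := by
    rw [Real.le_logb_iff_rpow_le (by norm_num) (by exact_mod_cast hn0), ← hlpred,
      Real.rpow_natCast]
    exact_mod_cast hln
  have hLl : Real.logb 2 (n : ℝ) ≤ l := by
    rw [Real.logb_le_iff_le_rpow (by norm_num) (by exact_mod_cast hn0), Real.rpow_natCast]
    exact_mod_cast (by omega : n ≤ 2 ^ l)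
  have hL : 2 ^ 49 ≤ Real.logb 2 (n : ℝ) := by linarith
  have hl2L : (l : ℝ) ≤ 2 * Real.logb 2 (n : ℝ) := by
    have : (1 : ℝ) ≤ 2 ^ 49 := one_le_pow₀ (by norm_num)
    linarith
  have hln30 : l ^ 30 ≤ n := by
    rw [div_le_iff₀ (by positivity)] at hl30
    refine le_trans ?_ hln
    have h1 : (2 : ℝ) ^ l = 2 * 2 ^ (l - 1) := by
      rw [← pow_succ', Nat.sub_add_cancel (by omega)]
    have h2 : (l : ℝ) ^ 30 ≤ 2 ^ (l - 1) := by linarith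
    exact_mod_cast h2
  have hG' : PolyExpander G l := hG.polyExpander hε hs hL hLl hl2L
  -- The number of parts is the least power of two that is at least `l`.
  have hh : 2 ^ Nat.clog 2 l ≤ 2 * l := by
    have h1 := Nat.pow_pred_clog_lt_self (b := 2) (by norm_num) (x := l) (by omega)
    have h2 : 0 < Nat.clog 2 l := Nat.clog_pos (by norm_num) (by omega)
    rw [Nat.pred_eq_sub_one] at h1
    rw [show Nat.clog 2 l = Nat.clog 2 l - 1 + 1 by omega, pow_succ]
    omega
  have hfail := hG'.prob_not_joins_le hl48 hnl hln30 hh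
  refine le_trans ?_ (one_sub_prob_le_setBernoulli (⟨1 / 6, by norm_num, by norm_num⟩) _ _
    fun V hV => Joins.connectsThrough hV (lt_of_lt_of_le (Nat.lt_of_succ_le hnl)
      (Nat.pow_le_pow_right (by norm_num) (Nat.le_pow_clog (b := 2) (by norm_num) l)))
      (pow_le_logb_pow hL hl2L))
  exact sub_le_sub_left (hfail.trans hlδ) 1
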